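/- Let an affine plane be given: points and lines such that two distinct points lie on exactly one line, every line has at least two points, there are three points not on a line, and through every point there is exactly one parallel to a given line (two lines being parallel if they are equal or have no common point). Its projective closure is obtained by adding to each line the ideal point given by its class of parallels, and by adding one line, on which exactly the ideal points lie. Triangles $123$ and $1'2'3'$ of the projective closure, with distinct corresponding vertices and distinct corresponding sides, are called perspective if $11',22',33'$ go through a point (the centre), and axial if the intersections of corresponding sides lie on a line (the axis). Suppose that the special Desargues theorem $D_2$ holds in the projective closure: two such triangles are perspective if and only if they are axial, whenever 1. each of the two triangles has a vertex on a side of the other ($3$ on $1'2'$ and $3'$ on $12$), or 2. two intersections of corresponding sides lie on lines connecting corresponding vertices ($23\cap 2'3'$ on $11'$ and $13\cap 1'3'$ on $22'$), or 3. one triangle has two vertices on sides of the other ($1$ on $2'3'$ and $2$ on $1'3'$). Suppose moreover that at least one of the following holds in the projective closure: * no complete quadrangle has collinear diagonal points; * the little Desargues theorem holds, that is, Desargues' theorem and its converse hold for such triangles when the centre lies on the axis. Precisely, let $O$ be a point on $11'$ and on $22'$ that is collinear with $B=13\cap 1'3'$ and $C=12\cap 1'2'$; then $O$ lies on $33'$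 if and only if $23\cap 2'3'$ lies on $BC$. Choose two lines intersecting at $O$, the $x$-axis and the $y$-axis, and unit points $x_e\neq O$ on the $x$-axis and $y_e\ne O$ on the $y$-axis. Segments are identified with the points of the $x$-axis. For a segment $b$ let $y_b$ be the point of the $y$-axis such that $b\,y_b\parallel x_ey_e$ (and $y_b=O$ if $b=O$). * *Sum.* Let $g$ be a parallel to the $x$-axis, different from it, meeting the $y$-axis in $P$. The parallel to the $y$-axis through $b$ meets $g$ in $Q$, and the parallel to $Pa$ through $Q$ meets the $x$-axis in $a+b$. * *Product.* The parallel to $y_e a$ through $y_b$ meets the $x$-axis in $ab$. Then $a+b$ and $ab$ are well defined for all segments $a,b$ (in particular $a+b$ does not depend on $g$), and with them the segments form an alternative field with zero element $O$ and unit element $x_e\ne O$: addition is an abelian group; $a(b+c)=ab+ac$ and $(b+c)a=ba+ca$; $a\cdot 1=a=1\cdot a$; $a(ab)=(aa)b$, $(ba)a=b(aa)$, $a(ba)=(ab)a$; and each $a\neq 0$ has a reciprocal $a^{-1}$ with $aa^{-1}=1=a^{-1}a$, $a(a^{-1}b)=a^{-1}(ab)=b$ and $(ba)a^{-1}=(ba^{-1})a=b$.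 Give a point $P$ the coordinates $(x,y)$, where $x$ is the point in which the parallel to the $y$-axis through $P$ meets the $x$-axis, and $y$ is the segment for which the parallel to the $x$-axis through $P$ meets the $y$-axis in $y_y$ (the point of the $y$-axis that corresponds to the segment $y$). This is a bijection between the points of the affine plane and the pairs of segments. The lines of the affine plane are exactly the point sets given by the equations $x=c$ and $y+ax=c$; they are also exactly the point sets given by the equations $y=c$ and $x+by=c$. -/

import Mathlib

/-! ### Alternative fields -/

/-- An alternative field: an additive abelian group with a (not necessarily associative or
commutative) unital multiplication satisfying both distributive laws (all this is
`NonAssocRing`), the weak associative laws, existence of reciprocals, and the weak inverse laws.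
The value `0⁻¹` is irrelevant. -/
class AlternativeField (K : Type*) extends NonAssocRing K, Inv K, Nontrivial K where
  left_alternative : ∀ a b : K, a * (a * b) = (a * a) * b
  right_alternative : ∀ a b : K, (b * a) * a = b * (a * a)
  flexible : ∀ a b : K, a * (b * a) = (a * b) * a
  mul_inv : ∀ a : K, a ≠ 0 → a * a⁻¹ = 1
  inv_mul : ∀ a : K, a ≠ 0 → a⁻¹ * a = 1
  mul_inv_mul : ∀ a b : K, a ≠ 0 → a * (a⁻¹ * b) = b
  inv_mul_mul : ∀ a b : K, a ≠ 0 → a⁻¹ * (a * b) = b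
  mul_mul_inv : ∀ a b : K, a ≠ 0 → (b * a) * a⁻¹ = b
  mul_inv_mul_right : ∀ a b : K, a ≠ 0 → (b * a⁻¹) * a = b

/-! ### Affine planes -/

/-- Two lines are parallel when they are equal or have no common point. -/
def Parallel {P L : Type*} [Membership P L] (l m : L) : Prop :=
  l = m ∨ ∀ p : P, ¬ (p ∈ l ∧ p ∈ m)

/-- The plane incidence axioms together with the parallel postulate. -/
class IsAffinePlane (P L : Type*) [Membership P L] : Prop where
  exists_line : ∀ p q : P, p ≠ q → ∃ l : L, p ∈ l ∧ q ∈ l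
  line_unique : ∀ (p q : P) (l m : L), p ≠ q → p ∈ l → q ∈ l → p ∈ m → q ∈ m → l = m
  two_points : ∀ l : L, ∃ p q : P, p ≠ q ∧ p ∈ l ∧ q ∈ l
  three_points : ∃ p q r : P, ¬ ∃ l : L, p ∈ l ∧ q ∈ l ∧ r ∈ l
  existsUnique_parallel : ∀ (p : P) (l : L), ∃! m : L, p ∈ m ∧ Parallel m l

/-! ### The projective closure -/

/-- Points of the projective closure: proper points, and ideal points, which are the classes of
all lines parallel to a given line. -/
inductive ProjPoint (P L : Type*) [Membership P L] where
  | proper (p : P) : ProjPoint P L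
  | ideal (c : {c : Set L // ∃ l : L, c = {m : L | Parallel m l}}) : ProjPoint P L

/-- Lines of the projective closure: proper lines, and the line at infinity. -/
inductive ProjLine (P L : Type*) [Membership P L] where
  | proper (l : L) : ProjLine P L
  | atInfinity : ProjLine P L

/-- Incidence in the projective closure. -/
def ProjIncident {P L : Type*} [Membership P L] : ProjPoint P L → ProjLine P L → Prop
  | .proper p, .proper l => p ∈ l
  | .proper _, .atInfinity => False
  | .ideal c, .proper l => l ∈ c.1
  | .ideal _, .atInfinity => True

/-! ### Configurations in the projective closure -/

/-- Three points of the projective closure lie on a line. -/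
def Col {P L : Type*} [Membership P L] (A B C : ProjPoint P L) : Prop :=
  ∃ l : ProjLine P L, ProjIncident A l ∧ ProjIncident B l ∧ ProjIncident C l

/-- `V` and `V'` are two proper triangles whose corresponding vertices are distinct and whose
corresponding sides are distinct. -/
structure TrianglePair {P L : Type*} [Membership P L] (V V' : Fin 3 → ProjPoint P L) :
    Prop where
  triangle : ¬ Col (V 0) (V 1) (V 2)
  triangle' : ¬ Col (V' 0) (V' 1) (V' 2)
  vertex_ne : ∀ i, V i ≠ V' i
  side_ne : ∀ i j, i ≠ j → ¬ ∃ l : ProjLine P L,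
    ProjIncident (V i) l ∧ ProjIncident (V j) l ∧ ProjIncident (V' i) l ∧ ProjIncident (V' j) l

/-- `Q` is an intersection of the corresponding sides `V i V j` and `V' i V' j`. -/
def IsSideMeet {P L : Type*} [Membership P L] (V V' : Fin 3 → ProjPoint P L) (i j : Fin 3)
    (Q : ProjPoint P L) : Prop :=
  Col Q (V i) (V j) ∧ Col Q (V' i) (V' j)

/-- The lines through corresponding vertices go through a point. -/
def Perspective {P L : Type*} [Membership P L] (V V' : Fin 3 → ProjPoint P L) : Prop :=
  ∃ O : ProjPoint P L, ∀ i, Col O (V i) (V' i)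

/-- The intersections of corresponding sides lie on a line. -/
def Axial {P L : Type*} [Membership P L] (V V' : Fin 3 → ProjPoint P L) : Prop :=
  ∃ A B C : ProjPoint P L,
    IsSideMeet V V' 1 2 A ∧ IsSideMeet V V' 0 2 B ∧ IsSideMeet V V' 0 1 C ∧ Col A B C

/-- The special Desargues theorem `D₂`, in its double form, in the projective closure of the
plane. Its three cases: (i) each of the two triangles has a vertex on a side of the other (the
two vertices are corresponding ones, on the sides opposite to them); (ii) two intersections of
corresponding sides lie on two lines connecting corresponding vertices; (iii) one triangle has
two vertices on sides of the other. -/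
def DesarguesTwo (P L : Type*) [Membership P L] : Prop :=
  ∀ V V' : Fin 3 → ProjPoint P L, TrianglePair V V' →
    ((Col (V 2) (V' 0) (V' 1) ∧ Col (V' 2) (V 0) (V 1)) ∨
      (∃ A B : ProjPoint P L, IsSideMeet V V' 1 2 A ∧ IsSideMeet V V' 0 2 B ∧
        Col A (V 0) (V' 0) ∧ Col B (V 1) (V' 1)) ∨
      (Col (V 0) (V' 1) (V' 2) ∧ Col (V 1) (V' 0) (V' 2))) →
    (Perspective V V' ↔ Axial V V')

/-- The little Desargues theorem (the centre of perspectivity lies on the axis), in its double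
form, in the projective closure of the plane. -/
def LittleDesargues (P L : Type*) [Membership P L] : Prop :=
  ∀ V V' : Fin 3 → ProjPoint P L, TrianglePair V V' → ∀ O B C : ProjPoint P L,
    Col O (V 0) (V' 0) → Col O (V 1) (V' 1) →
    IsSideMeet V V' 0 2 B → IsSideMeet V V' 0 1 C → Col O B C →
    (Col O (V 2) (V' 2) ↔ ∃ A, IsSideMeet V V' 1 2 A ∧ Col A B C)

/-- No complete quadrangle of the projective closure has collinear diagonal points. -/
def DiagonalPointsNotCollinear (P L : Type*) [Membership P L] : Prop :=
  ∀ A B C D X Y Z : ProjPoint P L,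
    ¬ Col A B C → ¬ Col A B D → ¬ Col A C D → ¬ Col B C D →
    Col X A B → Col X C D → Col Y A C → Col Y B D → Col Z A D → Col Z B C →
    ¬ Col X Y Z

/-! ### The segment calculus -/

/-- Two lines, the axes, intersecting at the origin, with a unit point on each. -/
structure Frame (P L : Type*) [Membership P L] where
  xAxis : L
  yAxis : L
  axes_ne : xAxis ≠ yAxis
  origin : P
  origin_mem_x : origin ∈ xAxis
  origin_mem_y : origin ∈ yAxis
  unitX : P
  unitX_mem : unitX ∈ xAxis
  unitX_ne : unitX ≠ origin
  unitY : P
  unitY_mem : unitY ∈ yAxis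
  unitY_ne : unitY ≠ origin

namespace Frame

variable {P L : Type*} [Membership P L] (F : Frame P L)

/-- Segments from the origin, identified with their endpoints on the `x`-axis. -/
def Segment : Type _ := {p : P // p ∈ F.xAxis}

/-- The segment whose two endpoints are both at the origin. -/
def zeroSegment : F.Segment := ⟨F.origin, F.origin_mem_x⟩

/-- The segment ending at the unit point. -/
def unitSegment : F.Segment := ⟨F.unitX, F.unitX_mem⟩

/-- `A B ∥ C D`: some line through `A`, `B` is parallel to some line through `C`, `D`.
Only the pairs `A ≠ B` determine a direction; if `C = D` there is always such a line. -/
def ParallelThrough (L : Type*) [Membership P L] (A B C D : P) : Prop :=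
  ∃ l m : L, A ∈ l ∧ B ∈ l ∧ C ∈ m ∧ D ∈ m ∧ Parallel l m

/-- `c` is constructed as the sum of `a` and `b` by means of the auxiliary line `g` (a parallel to
the `x`-axis): with `p` the intersection of `g` and the `y`-axis, the parallel to the `y`-axis
through `b` meets `g` in `q`, and the parallel to `p a` through `q` meets the `x`-axis in `c`. -/
def IsSum (g : L) (a b c : F.Segment) : Prop :=
  ∃ p q : P, p ∈ g ∧ p ∈ F.yAxis ∧
    q ∈ g ∧ (∃ n : L, Parallel n F.yAxis ∧ b.1 ∈ n ∧ q ∈ n) ∧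
    ParallelThrough L p a.1 q c.1

/-- The point `q` of the `y`-axis corresponds to the segment `b`, that is `q = y_b`: the line
through `b` and `q` is parallel to the line through the two unit points. -/
def Corresponds (b : F.Segment) (q : P) : Prop :=
  q ∈ F.yAxis ∧ ParallelThrough L F.unitX F.unitY b.1 q

/-- `c` is constructed as the product of `a` and `b`: the parallel through `y_b` to the line
connecting the unit point of the `y`-axis with `a` meets the `x`-axis in `c`. -/
def IsProduct (a b c : F.Segment) : Prop :=
  ∃ q : P, F.Corresponds b q ∧ ParallelThrough L F.unitY a.1 q c.1

/-- `p` has the coordinates `(x, y)`: the parallel to the `y`-axis through `p` meets the `x`-axis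
in `x`, and the parallel to the `x`-axis through `p` meets the `y`-axis in the point
corresponding to `y`. -/
def HasCoordinates (p : P) (x y : F.Segment) : Prop :=
  (∃ n : L, Parallel n F.yAxis ∧ p ∈ n ∧ x.1 ∈ n) ∧
    ∃ h : L, Parallel h F.xAxis ∧ p ∈ h ∧ ∃ q : P, q ∈ h ∧ F.Corresponds y q

end Frame

/-!
Both alternatives of the hypothesis make the projective closure a Moufang plane: for every line `h`
the elations with axis `h` act transitively on the points off `h` (`HasElations`). From there on
only elations are used.

* If the little Desargues theorem holds, the elation with axis `h` that sends `X` to `Y` is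
  constructed point by point, and the theorem says that the construction preserves lines
  (`LittleDesarguesLine.hasElations`). Points on the line `X Y` are mapped by means of an auxiliary
  pair; this needs a third line through the centre, and the plane of order two is treated apart.
* If diagonal points are not collinear, the first case of `D₂` states that the fourth harmonic line
  is unique (`FourthHarmonicLine`). Hence the harmonic construction with centre `Z` and axis `h`
  does not depend on the choices made in it, and it is an involutory collineation, the harmonic
  homology. The product of two harmonic homologies with the same axis and different centres has no
  fixed points off the axis, so that it is an elation, and since harmonic midpoints exist, all
  elations arise in this way (`FourthHarmonicLine.hasElations`).

The elations whose axis is the line at infinity are the translations of the affine plane. They make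
the points an abelian group in which lines are the cosets of the lines through `0`
(`exists_addCommGroup`, `mem_iff_sub_mem`). In it the geometric sum is addition, and `a b` is the
point `c` of the `x`-axis for which `c - y_b` has the direction of `a - y_e`; so `a (b + c) = a b +
a c` holds, and the lines not parallel to the `x`-axis have the equations `x + b y = c`. The
remaining laws come from three further kinds of elations.

* Shears along the `x`-axis give `(a - s) b = a b - s b` (`Frame.sub_mulPt`).
* A single shear along the `y`-axis gives for each `a ≠ -1` an `a'` with `a' (a b + b) = a b`, so
  `c = 1 + a` has the left inverse `1 - a'`: every left multiplication by `c ≠ 0` is inverted by a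
  left multiplication (`Frame.exists_mulPt_mulPt_add`).
* A single elation with centre `O` and the `x`-axis as axis does the same for right multiplications
  (`Frame.exists_mulPt_sub_mulPt`).

Finally, a ring with both inverse laws is alternative: with `L_a` the left multiplication by `a`,
`L_a⁻¹ - L_(1+a)⁻¹ = (L_a + L_a²)⁻¹`, whence `L_a²` is the left multiplication by `a a`
(`left_alternative_of_inverse`).
-/

/-! ### Projective planes, axial maps and elations -/

/-- A projective plane, given by points, lines and incidence. -/
class IsProjectivePlane (Pt Ln : Type*) [Membership Pt Ln] : Prop where
  exists_join : ∀ p q : Pt, ∃ l : Ln, p ∈ l ∧ q ∈ l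
  exists_meet : ∀ l m : Ln, ∃ p : Pt, p ∈ l ∧ p ∈ m
  eq_or_eq : ∀ {p q : Pt} {l m : Ln}, p ∈ l → q ∈ l → p ∈ m → q ∈ m → p = q ∨ l = m
  exists_three : ∀ l : Ln, ∃ p q r : Pt, p ∈ l ∧ q ∈ l ∧ r ∈ l ∧ p ≠ q ∧ p ≠ r ∧ q ≠ r
  exists_not_mem : ∀ l : Ln, ∃ p : Pt, p ∉ l

grind_pattern IsProjectivePlane.eq_or_eq => p ∈ l, q ∈ l, p ∈ m, q ∈ m

section Projective

open IsProjectivePlane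

variable {Pt Ln : Type*} [Membership Pt Ln]

/-- A map of the points that fixes the line `h` pointwise, preserves the complement of `h`, and
sends lines other than `h` into lines through the same point of `h`. -/
structure IsAxial (h : Ln) (f : Pt → Pt) : Prop where
  fix : ∀ {p}, p ∈ h → f p = p
  off : ∀ {p}, p ∉ h → f p ∉ h
  line : ∀ {p q d : Pt} {l : Ln}, p ∉ h → q ∉ h → d ∈ h → d ∈ l → p ∈ l → q ∈ l →
    ∃ l' : Ln, d ∈ l' ∧ f p ∈ l' ∧ f q ∈ l'

/-- The map `f` preserves each line through `Z`. -/
def IsCentral (Ln : Type*) [Membership Pt Ln] (Z : Pt) (f : Pt → Pt) : Prop :=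
  ∀ (p : Pt) (l : Ln), Z ∈ l → p ∈ l → f p ∈ l

theorem IsAxial.comp {h : Ln} {f g : Pt → Pt} (hf : IsAxial h f) (hg : IsAxial h g) :
    IsAxial h (f ∘ g) where
  fix hp := by simp [hg.fix hp, hf.fix hp]
  off hp := hf.off (hg.off hp)
  line hp hq hd hdl hpl hql := by
    obtain ⟨l', h1, h2, h3⟩ := hg.line hp hq hd hdl hpl hql
    exact hf.line (hg.off hp) (hg.off hq) hd h1 h2 h3

theorem IsCentral.comp {Z : Pt} {f g : Pt → Pt} (hf : IsCentral Ln Z f)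
    (hg : IsCentral Ln Z g) : IsCentral Ln Z (f ∘ g) :=
  fun p l hZ hp => hf _ l hZ (hg p l hZ hp)

theorem IsAxial.id (h : Ln) : IsAxial h (fun p : Pt => p) :=
  ⟨fun _ => rfl, fun h => h, fun _ _ _ h1 h2 h3 => ⟨_, h1, h2, h3⟩⟩

variable [IsProjectivePlane Pt Ln]

theorem exists_not_mem_two (l m : Ln) : ∃ p : Pt, p ∉ l ∧ p ∉ m := by
  obtain ⟨p, hp⟩ := exists_not_mem (Pt := Pt) l
  obtain ⟨q, hq⟩ := exists_not_mem (Pt := Pt) m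
  by_cases hpm : p ∈ m
  · by_cases hql : q ∈ l
    · obtain ⟨k, hpk, hqk⟩ := exists_join (Ln := Ln) p q
      obtain ⟨a, b, c, ha, hb, hc, hab, hac, hbc⟩ := exists_three (Pt := Pt) k
      by_contra! hcon
      have hor : ∀ x, x ∈ l ∨ x ∈ m := fun x => or_iff_not_imp_left.2 (hcon x)
      have h1 := hor a
      have h2 := hor b
      have h3 := hor c
      grind
    · exact ⟨q, hql, hq⟩
  · exact ⟨p, hp, hpm⟩

/-- A perspective map with its centre on the axis is the identity if it fixes a point off the
axis. -/
theorem IsAxial.eq_self {h : Ln} {f : Pt → Pt} {Z X : Pt} (hf : IsAxial h f)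
    (hc : IsCentral Ln Z f) (hZ : Z ∈ h) (hX : X ∉ h) (hfX : f X = X) (P : Pt) : f P = P := by
  have key : ∀ X : Pt, X ∉ h → f X = X → ∀ (k : Ln), Z ∈ k → X ∈ k → ∀ P : Pt, P ∉ k →
      P ∉ h → f P = P := by
    intro X hX hfX k hZk hXk P hPk hPh
    obtain ⟨l, hXl, hPl⟩ := exists_join (Ln := Ln) X P
    obtain ⟨D, hDl, hDh⟩ := exists_meet (Pt := Pt) l h
    obtain ⟨l', h1, h2, h3⟩ := hf.line hX hPh hDh hDl hXl hPl
    obtain ⟨n, hZn, hPn⟩ := exists_join (Ln := Ln) Z P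
    have h4 := hc P n hZn hPn
    rw [hfX] at h2
    have : l = l' := by grind
    have : l ≠ n := by grind
    grind
  obtain ⟨k, hZk, hXk⟩ := exists_join (Ln := Ln) Z X
  by_cases hPh : P ∈ h
  · exact hf.fix hPh
  by_cases hPk : P ∈ k
  · obtain ⟨Q, hQ1, hQ2⟩ := exists_not_mem_two (Pt := Pt) h k
    obtain ⟨n, hZn, hQn⟩ := exists_join (Ln := Ln) Z Q
    exact key Q hQ1 (key X hX hfX k hZk hXk Q hQ2 hQ1) n hZn hQn P (by grind) hPh
  · exact key X hX hfX k hZk hXk P hPk hPh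

theorem IsAxial.symm {h : Ln} {f : Equiv.Perm Pt} (hf : IsAxial h f) : IsAxial h f.symm where
  fix hp := by rw [Equiv.symm_apply_eq, hf.fix hp]
  off {p} hp hp' := by
    have := hf.fix hp'
    simp only [Equiv.apply_symm_apply] at this
    exact hp (this ▸ hp')
  line {p q d l} hp hq hd hdl hpl hql := by
    have off : ∀ {p}, p ∉ h → f.symm p ∉ h := by
      intro p hp hp'
      have := hf.fix hp'
      simp only [Equiv.apply_symm_apply] at this
      exact hp (this ▸ hp')
    by_cases hpq : p = q
    · subst hpq
      obtain ⟨k, h1, h2⟩ := exists_join (Ln := Ln) d (f.symm p)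
      exact ⟨k, h1, h2, h2⟩
    obtain ⟨k, hpk, hqk⟩ := exists_join (Ln := Ln) (f.symm p) (f.symm q)
    obtain ⟨D, hDk, hDh⟩ := exists_meet (Pt := Pt) k h
    obtain ⟨l', h1, h2, h3⟩ := hf.line (off hp) (off hq) hDh hDk hpk hqk
    simp only [Equiv.apply_symm_apply] at h2 h3
    have h4 : l' = l := by grind
    have h5 : D = d := by grind
    exact ⟨k, h5 ▸ hDk, hpk, hqk⟩

/-- A bijective axial map is a collineation. -/
theorem IsAxial.exists_line {h : Ln} {f : Equiv.Perm Pt} (hf : IsAxial h f) (l : Ln) :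
    ∃ m : Ln, (∀ d ∈ h, d ∈ l → d ∈ m) ∧ ∀ p, p ∈ l ↔ f p ∈ m := by
  by_cases hl : l = h
  · subst hl
    refine ⟨l, fun d hd _ => hd, fun p => ⟨fun hp => by rwa [hf.fix hp], fun hp => ?_⟩⟩
    by_contra hpl
    exact hf.off hpl hp
  obtain ⟨d, hdl, hdh⟩ := exists_meet (Pt := Pt) l h
  obtain ⟨a, b, c, ha, hb, hc, hab, hac, hbc⟩ := exists_three (Pt := Pt) l
  obtain ⟨p, hpl, hph⟩ : ∃ p, p ∈ l ∧ p ∉ h := by by_contra! hcon; grind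
  obtain ⟨m, hdm, hpm⟩ := exists_join (Ln := Ln) d (f p)
  refine ⟨m, ?_, fun q => ?_⟩
  · intro d' h1 h2
    have : d = d' := by grind
    exact this ▸ hdm
  have h0 := hf.off hph
  by_cases hqh : q ∈ h
  · rw [hf.fix hqh]; grind
  · have h1 := hf.off hqh
    constructor
    · intro hq
      obtain ⟨l', h2, h3, h4⟩ := hf.line hph hqh hdh hdl hpl hq
      grind
    · intro hq
      obtain ⟨l', h2, h3, h4⟩ := hf.symm.line h0 h1 hdh hdm hpm hq
      simp only [Equiv.symm_apply_apply] at h3 h4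
      grind

/-- A bijective axial map without fixed points off the axis has a centre on the axis: two of the
lines joining a point to its image meet in a fixed point. -/
theorem IsAxial.exists_center {h : Ln} {f : Equiv.Perm Pt} (hf : IsAxial h f)
    (hfree : ∀ p, p ∉ h → f p ≠ p) : ∃ Z ∈ h, IsCentral Ln Z f := by
  -- a line joining a point off the axis to its image is preserved
  have key : ∀ (p : Pt) (l : Ln), p ∉ h → p ∈ l → f p ∈ l → ∀ q ∈ l, f q ∈ l := by
    intro p l hp hpl hfp q hq
    obtain ⟨m, hm1, hm2⟩ := hf.exists_line l
    obtain ⟨d, hdl, hdh⟩ := exists_meet (Pt := Pt) l h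
    have h1 := (hm2 p).1 hpl
    have h2 := (hm2 q).1 hq
    have h3 := hm1 d hdh hdl
    have h4 := hf.off hp
    grind
  obtain ⟨p, hp⟩ := exists_not_mem (Pt := Pt) h
  obtain ⟨l, hpl, hfp⟩ := exists_join (Ln := Ln) p (f p)
  obtain ⟨Z, hZl, hZh⟩ := exists_meet (Pt := Pt) l h
  refine ⟨Z, hZh, fun q k hZk hqk => ?_⟩
  by_cases hqh : q ∈ h
  · rwa [hf.fix hqh]
  obtain ⟨n, hqn, hfq⟩ := exists_join (Ln := Ln) q (f q)
  obtain ⟨W, hWl, hWn⟩ := exists_meet (Pt := Pt) l n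
  have h1 := key p l hp hpl hfp W hWl
  have h2 := key q n hqh hqn hfq W hWn
  have h3 := hfree W
  by_cases hln : l = n
  · grind
  · have h4 : f W = W := by grind
    have h5 : W ∈ h := by by_contra h6; exact h3 h6 h4
    grind

/-- `f` is an elation with axis `h`: a collineation fixing all points of `h` and all lines
through some point of `h`. -/
def IsElation (h : Ln) (f : Equiv.Perm Pt) : Prop :=
  IsAxial h f ∧ ∃ Z ∈ h, IsCentral Ln Z f

theorem IsCentral.symm {Z : Pt} {h : Ln} {f : Equiv.Perm Pt} (hf : IsAxial h f) (hZ : Z ∈ h)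
    (hc : IsCentral Ln Z f) : IsCentral Ln Z f.symm := by
  intro p l hZl hp
  obtain ⟨n, h1, h2⟩ := exists_join (Ln := Ln) Z (f.symm p)
  have h3 := hc _ n h1 h2
  rw [Equiv.apply_symm_apply] at h3
  by_cases hpZ : p = Z
  · rw [hpZ, hf.symm.fix hZ]; exact hZl
  · grind

theorem IsElation.symm {h : Ln} {f : Equiv.Perm Pt} (hf : IsElation h f) :
    IsElation h f.symm := by
  obtain ⟨h1, Z, hZ, h2⟩ := hf
  exact ⟨h1.symm, Z, hZ, h2.symm h1 hZ⟩

theorem IsElation.eq_one {h : Ln} {f : Equiv.Perm Pt} (hf : IsElation h f) {X : Pt}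
    (hX : X ∉ h) (hfX : f X = X) : f = 1 := by
  obtain ⟨h1, Z, hZ, h2⟩ := hf
  exact Equiv.ext fun P => h1.eq_self h2 hZ hX hfX P

/-- An elation is determined by its axis and the image of one point off the axis. -/
theorem IsElation.ext {h : Ln} {f g : Equiv.Perm Pt} (hf : IsElation h f) (hg : IsElation h g)
    {X : Pt} (hX : X ∉ h) (hfg : f X = g X) : f = g := by
  by_cases hfX : f X = X
  · rw [hf.eq_one hX hfX, hg.eq_one hX (hfg ▸ hfX)]
  obtain ⟨hf1, Z, hZ, hf2⟩ := id hf
  obtain ⟨hg1, Z', hZ', hg2⟩ := id hg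
  -- both elations have their centre on the line joining `X` to its image
  have hZZ : Z = Z' := by
    obtain ⟨k, h1, h2⟩ := exists_join (Ln := Ln) Z X
    obtain ⟨k', h3, h4⟩ := exists_join (Ln := Ln) Z' X
    have h5 := hf2 X k h1 h2
    have h6 := hg2 X k' h3 h4
    grind
  subst hZZ
  have h1 : g.symm * f = 1 := by
    refine Equiv.ext fun P => ?_
    have := (hg1.symm.comp hf1).eq_self ((hg2.symm hg1 hZ).comp hf2) hZ hX (by simp [hfg]) P
    simpa using this
  ext P
  have := congrArg (fun t : Equiv.Perm Pt => g (t P)) h1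
  simpa using this

theorem IsElation.mul {h : Ln} {f g : Equiv.Perm Pt} (hf : IsElation h f) (hg : IsElation h g) :
    IsElation h (f * g) := by
  have hax : IsAxial h (f * g : Equiv.Perm Pt) := hf.1.comp hg.1
  refine ⟨hax, ?_⟩
  by_cases hfix : ∃ X, X ∉ h ∧ (f * g) X = X
  · obtain ⟨X, hX, h1⟩ := hfix
    have h2 : f = g.symm := by
      refine hf.ext hg.symm (hg.1.off hX) ?_
      simpa using h1
    obtain ⟨Z, hZ, -⟩ := hf.2
    refine ⟨Z, hZ, fun p l _ hp => ?_⟩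
    simpa [h2] using hp
  · push Not at hfix
    exact hax.exists_center hfix

/-- Every point off a line can be moved to every other such point by an elation with that axis:
the Moufang property. -/
def HasElations (Pt Ln : Type*) [Membership Pt Ln] : Prop :=
  ∀ (h : Ln) (X Y : Pt), X ∉ h → Y ∉ h → ∃ f : Equiv.Perm Pt, IsElation h f ∧ f X = Y

/-- Elations with the same axis and different centres commute: the image of a point `X` under either
product is the intersection of the same two lines. -/
theorem IsElation.commute_of_ne {h : Ln} {f g : Equiv.Perm Pt} (hf : IsElation h f)
    (hg : IsElation h g) {Z W : Pt} (hZ : Z ∈ h) (hW : W ∈ h) (hZW : Z ≠ W)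
    (hfZ : IsCentral Ln Z f) (hgW : IsCentral Ln W g) : f * g = g * f := by
  obtain ⟨X, hX⟩ := exists_not_mem (Pt := Pt) h
  refine (hf.mul hg).ext (hg.mul hf) hX ?_
  obtain ⟨a, ha1, ha2⟩ := exists_join (Ln := Ln) Z X
  obtain ⟨b, hb1, hb2⟩ := exists_join (Ln := Ln) W X
  have h1 := hfZ X a ha1 ha2
  have h2 := hgW X b hb1 hb2
  obtain ⟨a', h3, h4, h5⟩ := hg.1.line hX (hf.1.off hX) hZ ha1 ha2 h1
  obtain ⟨b', h6, h7, h8⟩ := hf.1.line hX (hg.1.off hX) hW hb1 hb2 h2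
  have h9 := hfZ _ a' h3 h4
  have h10 := hgW _ b' h6 h7
  have h11 := hg.1.off hX
  have h12 := hf.1.off hX
  have h13 := hf.1.off h11
  have h14 := hg.1.off h12
  simp only [Equiv.Perm.mul_apply]
  have : a' ≠ b' := by grind
  grind

/-- Elations with the same axis commute. If the centres are equal, both `g r` and `r` have another
centre for a suitable elation `r`, so that `f` commutes with both and hence with `g`. -/
theorem IsElation.commute (hE : HasElations Pt Ln) {h : Ln} {f g : Equiv.Perm Pt}
    (hf : IsElation h f) (hg : IsElation h g) : f * g = g * f := by
  obtain ⟨-, Z, hZ, hfZ⟩ := id hf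
  obtain ⟨-, W, hW, hgW⟩ := id hg
  by_cases hZW : Z = W
  swap
  · exact hf.commute_of_ne hg hZ hW hZW hfZ hgW
  subst hZW
  -- multiply `g` by an elation `r` with another centre
  obtain ⟨X, hX⟩ := exists_not_mem (Pt := Pt) h
  obtain ⟨k, hk1, hk2⟩ := exists_join (Ln := Ln) Z X
  obtain ⟨Y, hY1, hY2⟩ := exists_not_mem_two (Pt := Pt) h k
  obtain ⟨r, hr, hrX⟩ := hE h X Y hX hY1
  obtain ⟨hr1, V, hV, hrV⟩ := id hr
  have hnc : ¬ IsCentral Ln Z r := fun hc => hY2 (hrX ▸ hc X k hk1 hk2)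
  have hVZ : Z ≠ V := by rintro rfl; exact hnc hrV
  have hfr : f * r = r * f := hf.commute_of_ne hr hZ hV hVZ hfZ hrV
  obtain ⟨-, U, hU, hgrU⟩ := hg.mul hr
  have hUZ : Z ≠ U := by
    rintro rfl
    apply hnc
    have := (hgW.symm hg.1 hZ).comp hgrU
    intro p l h1 h2
    simpa using this p l h1 h2
  have h3 : f * (g * r) = (g * r) * f := hf.commute_of_ne (hg.mul hr) hZ hU hUZ hfZ hgrU
  have h4 : f * g * r = g * f * r := by rw [mul_assoc, h3, mul_assoc, mul_assoc, hfr]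
  exact mul_right_cancel h4

end Projective

/-! ### Elations from the little Desargues theorem -/

section LittleDesargues

open IsProjectivePlane

variable {Pt Ln : Type*} [Membership Pt Ln] [IsProjectivePlane Pt Ln]

/-- The point `P'` is the image of `P` under the elation with axis `h` and centre `Z` that sends
`X` to `Y`, constructed from the line `X P`. -/
def IsElationImage (h : Ln) (Z X Y P P' : Pt) : Prop :=
  P' ∉ h ∧ (∃ l : Ln, Z ∈ l ∧ P ∈ l ∧ P' ∈ l) ∧
    ∃ D ∈ h, ∃ l l' : Ln, D ∈ l ∧ X ∈ l ∧ P ∈ l ∧ D ∈ l' ∧ Y ∈ l' ∧ P' ∈ l'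

/-- The little Desargues theorem with centre `Z` and axis `h`, in terms of lines: if two
triangles are perspective from `Z` and two pairs of corresponding sides meet on `h`, then so does
the third pair. -/
def LittleDesarguesLine (Pt Ln : Type*) [Membership Pt Ln] : Prop :=
  ∀ (h k m n : Ln) (Z X X' Y Y' W W' D E : Pt) (a a' b b' c : Ln),
    Z ∈ h → Z ∈ k → Z ∈ m → Z ∈ n → X ∈ k → X' ∈ k → Y ∈ m → Y' ∈ m → W ∈ n → W' ∈ n →
    X ∉ h → X' ∉ h → Y ∉ h → Y' ∉ h → W ∉ h → W' ∉ h → k ≠ m → k ≠ n → m ≠ n →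
    X ≠ X' → D ∈ h → E ∈ h →
    D ∈ a → X ∈ a → Y ∈ a → D ∈ a' → X' ∈ a' → Y' ∈ a' →
    E ∈ b → X ∈ b → W ∈ b → E ∈ b' → X' ∈ b' → W' ∈ b' →
    D ≠ E → Y ∈ c → W ∈ c → ∃ F ∈ h, F ∈ c ∧ ∃ c' : Ln, F ∈ c' ∧ Y' ∈ c' ∧ W' ∈ c'

theorem exists_isElationImage {h k : Ln} {Z X Y P : Pt} (hZ : Z ∈ h) (hZk : Z ∈ k) (hX : X ∈ k)
    (hY : Y ∈ k) (hXh : X ∉ h) (hYh : Y ∉ h) (hPk : P ∉ k) (hPh : P ∉ h) :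
    ∃ P', IsElationImage h Z X Y P P' := by
  obtain ⟨l, hXl, hPl⟩ := exists_join (Ln := Ln) X P
  obtain ⟨D, hDl, hDh⟩ := exists_meet (Pt := Pt) l h
  obtain ⟨l', hDl', hYl'⟩ := exists_join (Ln := Ln) D Y
  obtain ⟨m, hZm, hPm⟩ := exists_join (Ln := Ln) Z P
  obtain ⟨P', hP1, hP2⟩ := exists_meet (Pt := Pt) l' m
  exact ⟨P', by grind, ⟨m, hZm, hPm, hP2⟩, D, hDh, l, l', hDl, hXl, hPl, hDl', hYl', hP1⟩

/-- Corresponding sides of two triangles inscribed in three lines through `Z`, two pairs of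
which meet on `h`: the degenerate cases included. -/
theorem IsElationImage.line (hL : LittleDesarguesLine Pt Ln) {h k : Ln} {Z X Y P P' Q Q' : Pt}
    (hZ : Z ∈ h) (hZk : Z ∈ k) (hX : X ∈ k) (hY : Y ∈ k) (hXh : X ∉ h) (hYh : Y ∉ h)
    (hXY : X ≠ Y) (hPk : P ∉ k) (hPh : P ∉ h) (hQk : Q ∉ k) (hQh : Q ∉ h)
    (hP : IsElationImage h Z X Y P P') (hQ : IsElationImage h Z X Y Q Q')
    {D : Pt} {l : Ln} (hD : D ∈ h) (hDl : D ∈ l) (hPl : P ∈ l) (hQl : Q ∈ l) :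
    ∃ l' : Ln, D ∈ l' ∧ P' ∈ l' ∧ Q' ∈ l' := by
  obtain ⟨hP1, ⟨m, m1, m2, m3⟩, E, hE, a, a', a1, a2, a3, a4, a5, a6⟩ := hP
  obtain ⟨hQ1, ⟨n, n1, n2, n3⟩, F, hF, b, b', b1, b2, b3, b4, b5, b6⟩ := hQ
  by_cases hmn : m = n
  · subst hmn
    have : D = Z ∨ P = Q := by grind
    rcases this with rfl | rfl
    · exact ⟨m, m1, m3, n3⟩
    · have : P' = Q' := by grind
      subst this
      obtain ⟨l', h1, h2⟩ := exists_join (Ln := Ln) D P'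
      exact ⟨l', h1, h2, h2⟩
  by_cases hEF : E = F
  · subst hEF
    have h1 : a = b := by grind
    have h2 : a' = b' := by grind
    have h3 : l = a := by grind
    have h4 : D = E := by grind
    subst h4 h2
    exact ⟨a', a4, a6, b6⟩
  obtain ⟨G, hG, hGl, c', h1, h2, h3⟩ := hL h k m n Z X Y P P' Q Q' E F a a' b b' l hZ hZk m1 n1
    hX hY m2 m3 n2 n3 hXh hYh hPh hP1 hQh hQ1 (by grind) (by grind) hmn hXY hE hF a1 a2 a3 a4 a5 a6
    b1 b2 b3 b4 b5 b6 hEF hPl hQl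
  have : D = G := by grind
  subst this
  exact ⟨c', h1, h2, h3⟩

theorem IsElationImage.unique {h k : Ln} {Z X Y P P' Q' : Pt} (hZ : Z ∈ h) (hZk : Z ∈ k)
    (hX : X ∈ k) (hY : Y ∈ k) (hXh : X ∉ h) (hYh : Y ∉ h) (hPk : P ∉ k) (hPh : P ∉ h)
    (hP : IsElationImage h Z X Y P P') (hQ : IsElationImage h Z X Y P Q') : P' = Q' := by
  obtain ⟨hP1, ⟨m, m1, m2, m3⟩, E, hE, a, a', a1, a2, a3, a4, a5, a6⟩ := hP
  obtain ⟨hQ1, ⟨n, n1, n2, n3⟩, F, hF, b, b', b1, b2, b3, b4, b5, b6⟩ := hQ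
  grind

omit [IsProjectivePlane Pt Ln] in
theorem IsElationImage.swap {h k : Ln} {Z X Y P P' : Pt} (hZk : Z ∈ k) (hX : X ∈ k) (hY : Y ∈ k)
    (hYh : Y ∉ h) (hP : IsElationImage h Z X Y P P') : IsElationImage h Z P P' X Y := by
  obtain ⟨hP1, m, E, hE, a, a', a1, a2, a3, a4, a5, a6⟩ := hP
  exact ⟨hYh, ⟨k, hZk, hX, hY⟩, E, hE, a, a', a1, a3, a2, a4, a6, a5⟩

omit [IsProjectivePlane Pt Ln] in
theorem IsElationImage.symm {h : Ln} {Z X Y P P' : Pt}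
    (hPh : P ∉ h) (hP : IsElationImage h Z X Y P P') : IsElationImage h Z Y X P' P := by
  obtain ⟨hP1, ⟨m, m1, m2, m3⟩, E, hE, a, a', a1, a2, a3, a4, a5, a6⟩ := hP
  exact ⟨hPh, ⟨m, m1, m3, m2⟩, E, hE, a', a, a4, a5, a6, a1, a2, a3⟩

/-- In a plane covered by three lines `h`, `k`, `q` through `Z`, two lines meeting `k` and `q` in
different points off `h` meet on `h`. -/
theorem mem_of_covered {h k q : Ln} {Z : Pt} (hZ : Z ∈ h) (hZk : Z ∈ k) (hZq : Z ∈ q)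
    (hkq : k ≠ q) (hcov : ∀ V : Pt, V ∈ h ∨ V ∈ k ∨ V ∈ q) {x₁ x₂ q₁ q₂ : Pt} {a b : Ln}
    (h1 : x₁ ∈ k) (h2 : x₂ ∈ k) (h3 : q₁ ∈ q) (h4 : q₂ ∈ q)
    (h5 : x₁ ∉ h) (h6 : x₂ ∉ h) (h7 : q₁ ∉ h) (h8 : q₂ ∉ h) (h9 : x₁ ≠ x₂) (h10 : q₁ ≠ q₂)
    (h11 : x₁ ∈ a) (h12 : q₁ ∈ a) (h13 : x₂ ∈ b) (h14 : q₂ ∈ b) (D : Pt) (h15 : D ∈ h)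
    (h16 : D ∈ a) : D ∈ b := by
  obtain ⟨V, hVa, hVb⟩ := exists_meet (Pt := Pt) a b
  have h17 := hcov V
  clear hcov
  grind

open Classical in
/-- The elation with axis `h` and centre `Z` sending `X` to `Y`; points of the line `k` joining
`X` and `Y` are mapped by means of the auxiliary pair `Q`, `Q'`. -/
noncomputable def elationMap (h k : Ln) (Z X Y Q Q' P : Pt) : Pt :=
  if P ∈ h then P
  else if P ∈ k then @Classical.epsilon Pt ⟨P⟩ (IsElationImage h Z Q Q' P)
  else @Classical.epsilon Pt ⟨P⟩ (IsElationImage h Z X Y P)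

section Map

variable {h k : Ln} {Z X Y Q Q' : Pt}

theorem elationMap_of_notMem (hZ : Z ∈ h) (hZk : Z ∈ k) (hX : X ∈ k) (hY : Y ∈ k) (hXh : X ∉ h)
    (hYh : Y ∉ h) {P : Pt} (hPh : P ∉ h) (hPk : P ∉ k) :
    IsElationImage h Z X Y P (elationMap h k Z X Y Q Q' P) := by
  rw [elationMap, if_neg hPh, if_neg hPk]
  exact Classical.epsilon_spec (exists_isElationImage hZ hZk hX hY hXh hYh hPk hPh)

theorem elationMap_of_mem (hZ : Z ∈ h) {q : Ln} (hZq : Z ∈ q) (hQ : Q ∈ q) (hQ' : Q' ∈ q)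
    (hQh : Q ∉ h) (hQ'h : Q' ∉ h) {P : Pt} (hPh : P ∉ h) (hPk : P ∈ k) (hPq : P ∉ q) :
    IsElationImage h Z Q Q' P (elationMap h k Z X Y Q Q' P) := by
  rw [elationMap, if_neg hPh, if_pos hPk]
  exact Classical.epsilon_spec (exists_isElationImage hZ hZq hQ hQ' hQh hQ'h hPq hPh)

variable (hL : LittleDesarguesLine Pt Ln) (hZ : Z ∈ h) (hZk : Z ∈ k) (hX : X ∈ k)
  (hY : Y ∈ k) (hXh : X ∉ h) (hYh : Y ∉ h) (hXY : X ≠ Y) (hQk : Q ∉ k) (hQh : Q ∉ h)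
  (hQ : IsElationImage h Z X Y Q Q')

include hL hZ hZk hX hY hXh hYh hXY hQk hQh hQ

/-- The critical case in the proof that `elationMap` preserves lines: one point lies on `k`, the
other does not. If both points lie on lines of the two given pairs, either a third line through `Z`
provides another pair, or all points are covered by three lines and `mem_of_covered` applies. -/
theorem elationMap_line_aux {P R D : Pt} {l : Ln} (hPh : P ∉ h) (hRh : R ∉ h) (hD : D ∈ h)
    (hDl : D ∈ l) (hPl : P ∈ l) (hRl : R ∈ l) (hPk : P ∈ k) (hRk : R ∉ k) :
    ∃ l' : Ln, D ∈ l' ∧ elationMap h k Z X Y Q Q' P ∈ l' ∧ elationMap h k Z X Y Q Q' R ∈ l' := by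
  obtain ⟨q, hZq, hQq, hQ'q⟩ := hQ.2.1
  have hQ'h := hQ.1
  have hkq : k ≠ q := by rintro rfl; exact hQk hQq
  have hQQ' : Q ≠ Q' := by
    obtain ⟨-, -, E, hE, a, a', a1, a2, a3, a4, a5, a6⟩ := hQ
    grind
  have hXQ : X ∉ q := by grind
  have hPq : P ∉ q := by grind
  have hQX := hQ.swap hZk hX hY hYh
  have hP := elationMap_of_mem (k := k) (X := X) (Y := Y) hZ hZq hQq hQ'q hQh hQ'h hPh hPk hPq
  have hR := elationMap_of_notMem (Q := Q) (Q' := Q') hZ hZk hX hY hXh hYh hRh hRk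
  by_cases hRq : R ∉ q
  · -- here `R` may be mapped by means of the auxiliary pair as well
    have hR' : IsElationImage h Z Q Q' R (elationMap h k Z X Y Q Q' R) := by
      obtain ⟨D', h1, h2⟩ : ∃ D' ∈ h, ∃ l : Ln, D' ∈ l ∧ Q ∈ l ∧ R ∈ l := by
        obtain ⟨l, h1, h2⟩ := exists_join (Ln := Ln) Q R
        obtain ⟨D', h3, h4⟩ := exists_meet (Pt := Pt) l h
        exact ⟨D', h4, l, h3, h1, h2⟩
      obtain ⟨l, h3, h4, h5⟩ := h2
      obtain ⟨l', h6, h7, h8⟩ := IsElationImage.line hL hZ hZk hX hY hXh hYh hXY hQk hQh hRk hRh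
        hQ hR h1 h3 h4 h5
      exact ⟨hR.1, hR.2.1, D', h1, l, l', h3, h4, h5, h6, h7, h8⟩
    exact IsElationImage.line hL hZ hZq hQq hQ'q hQh hQ'h hQQ' hPq hPh hRq hRh hP hR' hD hDl
      hPl hRl
  push Not at hRq
  by_cases hthird : ∃ W : Pt, W ∉ h ∧ W ∉ k ∧ W ∉ q
  · -- a pair on a third line through the centre links `P` and `R`
    obtain ⟨W, hWh, hWk, hWq⟩ := hthird
    obtain ⟨W', hW⟩ := exists_isElationImage hZ hZk hX hY hXh hYh hWk hWh
    obtain ⟨w, hZw, hWw, hW'w⟩ := hW.2.1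
    have hWW' : W ≠ W' := by
      obtain ⟨-, -, E, hE, a, a', a1, a2, a3, a4, a5, a6⟩ := hW
      grind
    have link : ∀ {S T S' T' : Pt}, (∀ {D : Pt} {l : Ln}, D ∈ h → D ∈ l → S ∈ l → T ∈ l →
        ∃ l' : Ln, D ∈ l' ∧ S' ∈ l' ∧ T' ∈ l') → T' ∉ h →
        (∃ l : Ln, Z ∈ l ∧ T ∈ l ∧ T' ∈ l) → IsElationImage h Z S S' T T' := by
      intro S T S' T' h0 h1 h2
      obtain ⟨l, h3, h4⟩ := exists_join (Ln := Ln) S T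
      obtain ⟨D', h5, h6⟩ := exists_meet (Pt := Pt) l h
      obtain ⟨l', h7, h8, h9⟩ := h0 h6 h5 h3 h4
      exact ⟨h1, h2, D', h6, l, l', h5, h3, h4, h7, h8, h9⟩
    have hWR := link (IsElationImage.line hL hZ hZk hX hY hXh hYh hXY hWk hWh hRk hRh hW hR)
      hR.1 hR.2.1
    have hQW := link (IsElationImage.line hL hZ hZk hX hY hXh hYh hXY hQk hQh hWk hWh hQ hW)
      hW.1 hW.2.1
    have hWP := link (IsElationImage.line hL hZ hZq hQq hQ'q hQh hQ'h hQQ' hWq hWh hPq hPh hQW hP)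
      hP.1 hP.2.1
    exact IsElationImage.line hL hZ hZw hWw hW'w hWh hW.1 hWW' (by grind) hPh (by grind) hRh
      hWP hWR hD hDl hPl hRl
  · -- without a third line through the centre, the lines `X Q` and `P R` meet on `h`
    push Not at hthird
    have hkq' : ∀ V : Pt, V ∈ h ∨ V ∈ k ∨ V ∈ q := fun V => by
      by_contra! hV
      exact hV.2.2 (hthird V hV.1 hV.2.1)
    clear hthird
    by_cases hRQ : R = Q
    · subst hRQ
      obtain ⟨hP1, -, E, hE, a, a', a1, a2, a3, a4, a5, a6⟩ := hP
      have : elationMap h k Z X Y R Q' R = Q' := hR.unique hZ hZk hX hY hXh hYh hRk hRh hQ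
      rw [this]
      have : E = D := by clear hkq' hQ hQX hR hL; grind
      subst this
      exact ⟨a', a4, a6, a5⟩
    by_cases hPX : P = X
    · subst hPX
      obtain ⟨hR1, -, E, hE, a, a', a1, a2, a3, a4, a5, a6⟩ := hR
      have : elationMap h k Z P Y Q Q' P = Y := hP.unique hZ hZq hQq hQ'q hQh hQ'h hPq hPh hQX
      rw [this]
      have : E = D := by clear hkq' hQ hQX hP hL; grind
      subst this
      exact ⟨a', a4, a5, a6⟩
    set P' := elationMap h k Z X Y Q Q' P
    set R' := elationMap h k Z X Y Q Q' R
    obtain ⟨hP1, ⟨m, m1, m2, m3⟩, E, hE, a, a', a1, a2, a3, a4, a5, a6⟩ := hP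
    obtain ⟨hR1, ⟨n, n1, n2, n3⟩, F, hF, b, b', b1, b2, b3, b4, b5, b6⟩ := hR
    obtain ⟨-, -, G, hG, c, c', c1, c2, c3, c4, c5, c6⟩ := hQ
    have hmk : m = k := by grind
    have hnq : n = q := by grind
    subst hmk hnq
    have h1 : P' ≠ Y := by clear hkq' hQX hL; grind
    have h2 : R' ≠ Q' := by clear hkq' hQX hL; grind
    have h3 : D ∈ c := mem_of_covered hZ hZk hZq hkq hkq' hPk hX hRq hQq hPh hXh hRh hQh hPX hRQ
      hPl hRl c2 c3 D hD hDl
    have h4 : D = G := by grind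
    subst h4
    obtain ⟨l', h5, h6⟩ := exists_join (Ln := Ln) P' R'
    exact ⟨l', mem_of_covered hZ hZk hZq hkq hkq' hY m3 hQ'q n3 hYh hP1 hQ'h hR1 h1.symm h2.symm
      c5 c6 h5 h6 D hD c4, h5, h6⟩

theorem isAxial_elationMap : IsAxial h (elationMap h k Z X Y Q Q') where
  fix hp := by rw [elationMap, if_pos hp]
  off {p} hp := by
    obtain ⟨q, hZq, hQq, hQ'q⟩ := hQ.2.1
    by_cases hpk : p ∈ k
    · exact (elationMap_of_mem hZ hZq hQq hQ'q hQh hQ.1 hp hpk (by grind)).1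
    · exact (elationMap_of_notMem hZ hZk hX hY hXh hYh hp hpk).1
  line {P R D l} hPh hRh hD hDl hPl hRl := by
    obtain ⟨q, hZq, hQq, hQ'q⟩ := hQ.2.1
    have hQ'h := hQ.1
    by_cases hPk : P ∈ k <;> by_cases hRk : R ∈ k
    · have hP := elationMap_of_mem (k := k) (X := X) (Y := Y) hZ hZq hQq hQ'q hQh hQ'h hPh hPk
        (by grind)
      have hR := elationMap_of_mem (k := k) (X := X) (Y := Y) hZ hZq hQq hQ'q hQh hQ'h hRh hRk
        (by grind)
      obtain ⟨m, m1, m2, m3⟩ := hP.2.1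
      obtain ⟨n, n1, n2, n3⟩ := hR.2.1
      by_cases hPR : P = R
      · subst hPR
        obtain ⟨l', h1, h2⟩ := exists_join (Ln := Ln) D (elationMap h k Z X Y Q Q' P)
        exact ⟨l', h1, h2, h2⟩
      · exact ⟨k, by grind, by grind, by grind⟩
    · exact elationMap_line_aux hL hZ hZk hX hY hXh hYh hXY hQk hQh hQ hPh hRh hD hDl hPl hRl
        hPk hRk
    · obtain ⟨l', h1, h2, h3⟩ := elationMap_line_aux hL hZ hZk hX hY hXh hYh hXY hQk hQh hQ hRh
        hPh hD hDl hRl hPl hRk hPk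
      exact ⟨l', h1, h3, h2⟩
    · exact IsElationImage.line hL hZ hZk hX hY hXh hYh hXY hPk hPh hRk hRh
        (elationMap_of_notMem hZ hZk hX hY hXh hYh hPh hPk)
        (elationMap_of_notMem hZ hZk hX hY hXh hYh hRh hRk) hD hDl hPl hRl

omit hL hXY in
theorem isCentral_elationMap : IsCentral Ln Z (elationMap h k Z X Y Q Q') := by
  intro P l hZl hPl
  obtain ⟨q, hZq, hQq, hQ'q⟩ := hQ.2.1
  by_cases hPh : P ∈ h
  · rwa [elationMap, if_pos hPh]
  by_cases hPk : P ∈ k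
  · obtain ⟨m, m1, m2, m3⟩ := (elationMap_of_mem (k := k) (X := X) (Y := Y) hZ hZq hQq hQ'q hQh
      hQ.1 hPh hPk (by grind)).2.1
    grind
  · obtain ⟨m, m1, m2, m3⟩ := (elationMap_of_notMem (Q := Q) (Q' := Q') hZ hZk hX hY hXh hYh hPh
      hPk).2.1
    grind

omit hL hXY in
theorem elationMap_apply : elationMap h k Z X Y Q Q' X = Y := by
  obtain ⟨q, hZq, hQq, hQ'q⟩ := hQ.2.1
  have hXq : X ∉ q := by grind
  exact (elationMap_of_mem hZ hZq hQq hQ'q hQh hQ.1 hXh hX hXq).unique hZ hZq hQq hQ'q hQh hQ.1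
    hXq hXh (hQ.swap hZk hX hY hYh)

end Map

/-- The little Desargues theorem provides all elations: the maps for the pairs `X`, `Y` and `Y`, `X`
are inverse to each other, since their products are central and axial and have a fixed point off the
axis. -/
theorem LittleDesarguesLine.hasElations (hL : LittleDesarguesLine Pt Ln) :
    HasElations Pt Ln := by
  intro h X Y hXh hYh
  by_cases hXY : X = Y
  · subst hXY
    obtain ⟨Z, -, -, hZ, -⟩ := exists_three (Pt := Pt) h
    exact ⟨1, ⟨IsAxial.id h, Z, hZ, fun _ _ _ hp => hp⟩, rfl⟩
  obtain ⟨k, hX, hY⟩ := exists_join (Ln := Ln) X Y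
  obtain ⟨Z, hZk, hZ⟩ := exists_meet (Pt := Pt) k h
  obtain ⟨Q, hQh, hQk⟩ := exists_not_mem_two (Pt := Pt) h k
  obtain ⟨Q', hQ⟩ := exists_isElationImage hZ hZk hX hY hXh hYh hQk hQh
  have hQ'k : Q' ∉ k := by
    obtain ⟨h1, ⟨m, m1, m2, m3⟩, -⟩ := hQ
    grind
  have hQs := hQ.symm hQh
  have f1 := isAxial_elationMap hL hZ hZk hX hY hXh hYh hXY hQk hQh hQ
  have f2 := isCentral_elationMap hZ hZk hX hY hXh hYh hQk hQh hQ
  have f3 := elationMap_apply hZ hZk hX hY hXh hYh hQk hQh hQ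
  have g1 := isAxial_elationMap hL hZ hZk hY hX hYh hXh (Ne.symm hXY) hQ'k hQ.1 hQs
  have g2 := isCentral_elationMap hZ hZk hY hX hYh hXh hQ'k hQ.1 hQs
  have g3 := elationMap_apply hZ hZk hY hX hYh hXh hQ'k hQ.1 hQs
  refine ⟨⟨elationMap h k Z X Y Q Q', elationMap h k Z Y X Q' Q, fun P => ?_, fun P => ?_⟩,
    ⟨f1, Z, hZ, f2⟩, f3⟩
  · exact (g1.comp f1).eq_self (g2.comp f2) hZ hXh (by simp [f3, g3]) P
  · exact (f1.comp g1).eq_self (f2.comp g2) hZ hYh (by simp [f3, g3]) P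

end LittleDesargues

/-! ### Elations from the uniqueness of fourth harmonic lines -/

section Harmonic

open IsProjectivePlane

variable {Pt Ln : Type*} [Membership Pt Ln] [IsProjectivePlane Pt Ln]

/-- The first case of `D₂`, in terms of lines: three lines through `O` cut the lines `l`, `l'`
through `C` in the points `Pᵢ`, `Qᵢ`; then `P₂ Q₃ ∩ P₃ Q₂` and `P₁ Q₃ ∩ P₃ Q₁` are collinear
with `C`. In other words, the fourth harmonic line of `C O` with respect to `l`, `l'` does not
depend on the choice of two lines through `O`. -/
def FourthHarmonicLine (Pt Ln : Type*) [Membership Pt Ln] : Prop :=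
  ∀ (l l' n₁ n₂ n₃ s s' t t' : Ln) (C O P₁ P₂ P₃ Q₁ Q₂ Q₃ A B : Pt),
    l ≠ l' → C ∈ l → C ∈ l' → O ∉ l → O ∉ l' → n₁ ≠ n₂ → n₁ ≠ n₃ → n₂ ≠ n₃ →
    O ∈ n₁ → O ∈ n₂ → O ∈ n₃ → C ∉ n₁ → C ∉ n₂ → C ∉ n₃ →
    P₁ ∈ n₁ → P₁ ∈ l → Q₁ ∈ n₁ → Q₁ ∈ l' → P₂ ∈ n₂ → P₂ ∈ l → Q₂ ∈ n₂ → Q₂ ∈ l' →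
    P₃ ∈ n₃ → P₃ ∈ l → Q₃ ∈ n₃ → Q₃ ∈ l' →
    P₂ ∈ s → Q₃ ∈ s → A ∈ s → P₃ ∈ s' → Q₂ ∈ s' → A ∈ s' →
    P₁ ∈ t → Q₃ ∈ t → B ∈ t → P₃ ∈ t' → Q₁ ∈ t' → B ∈ t' →
    ∃ k : Ln, A ∈ k ∧ B ∈ k ∧ C ∈ k

/-- The diagonal points of a complete quadrangle are not collinear, in terms of lines. -/
def FanoLine (Pt Ln : Type*) [Membership Pt Ln] : Prop :=
  ∀ (A B C D X Y Z : Pt) (ab cd ac bd ad bc k : Ln),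
    A ≠ B → C ≠ D → A ∈ ab → B ∈ ab → C ∉ ab → D ∉ ab → C ∈ cd → D ∈ cd → A ∉ cd → B ∉ cd →
    A ∈ ac → C ∈ ac → B ∈ bd → D ∈ bd → A ∈ ad → D ∈ ad → B ∈ bc → C ∈ bc →
    X ∈ ab → X ∈ cd → Y ∈ ac → Y ∈ bd → Z ∈ ad → Z ∈ bc → X ∈ k → Y ∈ k → Z ∉ k

/-- The construction of the fourth harmonic point `X'` of `X` with respect to `Z` and the
intersection `D` of `Z X` with `h`, by means of the quadrangle `H`, `G`, `A`, `B` with two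
vertices `H`, `G` on `h`. -/
structure HarmonicFigure (h k a b c d e : Ln) (Z H G X X' D A B : Pt) : Prop where
  H_h : H ∈ h
  G_h : G ∈ h
  H_ne_G : H ≠ G
  H_k : H ∉ k
  G_k : G ∉ k
  Z_h : Z ∉ h
  X_h : X ∉ h
  X_ne_Z : X ≠ Z
  D_h : D ∈ h
  D_k : D ∈ k
  Z_k : Z ∈ k
  X_k : X ∈ k
  X'_k : X' ∈ k
  H_a : H ∈ a
  Z_a : Z ∈ a
  B_a : B ∈ a
  X_b : X ∈ b
  G_b : G ∈ b
  B_b : B ∈ b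
  D_c : D ∈ c
  A_c : A ∈ c
  B_c : B ∈ c
  Z_d : Z ∈ d
  G_d : G ∈ d
  A_d : A ∈ d
  H_e : H ∈ e
  A_e : A ∈ e
  X'_e : X' ∈ e

/-- `X'` is obtained from `X` by the harmonic construction with centre `Z`, axis `h` and the
vertices `H`, `G` on `h`. -/
def IsHarmonic (h : Ln) (Z H G X X' : Pt) : Prop :=
  ∃ (k a b c d e : Ln) (D A B : Pt), HarmonicFigure h k a b c d e Z H G X X' D A B

theorem exists_isHarmonic {h k : Ln} {Z H G X : Pt} (hH : H ∈ h) (hG : G ∈ h) (hHG : H ≠ G)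
    (hHk : H ∉ k) (hGk : G ∉ k) (hZ : Z ∉ h) (hX : X ∉ h) (hXZ : X ≠ Z) (hZk : Z ∈ k)
    (hXk : X ∈ k) : ∃ X', IsHarmonic h Z H G X X' := by
  obtain ⟨D, hDk, hDh⟩ := exists_meet (Pt := Pt) k h
  obtain ⟨a, a1, a2⟩ := exists_join (Ln := Ln) H Z
  obtain ⟨b, b1, b2⟩ := exists_join (Ln := Ln) X G
  obtain ⟨d, d1, d2⟩ := exists_join (Ln := Ln) Z G
  obtain ⟨B, B1, B2⟩ := exists_meet (Pt := Pt) a b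
  obtain ⟨c, c1, c2⟩ := exists_join (Ln := Ln) D B
  obtain ⟨A, A1, A2⟩ := exists_meet (Pt := Pt) c d
  obtain ⟨e, e1, e2⟩ := exists_join (Ln := Ln) H A
  obtain ⟨X', h1, h2⟩ := exists_meet (Pt := Pt) k e
  exact ⟨X', k, a, b, c, d, e, D, A, B, by constructor <;> assumption⟩

theorem HarmonicFigure.notMem {h k a b c d e : Ln} {Z H G X X' D A B : Pt}
    (hf : HarmonicFigure h k a b c d e Z H G X X' D A B) : X' ∉ h ∧ X' ≠ Z := by
  cases hf
  constructor <;> grind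

theorem IsHarmonic.symm {h : Ln} {Z H G X X' : Pt} (hX : IsHarmonic h Z H G X X') :
    IsHarmonic h Z G H X' X := by
  obtain ⟨k, a, b, c, d, e, D, A, B, hf⟩ := hX
  have h1 := hf.notMem
  obtain ⟨⟩ := hf
  refine ⟨k, d, e, c, a, b, D, B, A, ?_⟩
  constructor <;> first | assumption | exact h1.1 | exact h1.2 | (apply Ne.symm; assumption)

theorem IsHarmonic.unique {h : Ln} {Z H G X X' X'' : Pt} (hX : IsHarmonic h Z H G X X')
    (hX' : IsHarmonic h Z H G X X'') : X' = X'' := by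
  obtain ⟨k, a, b, c, d, e, D, A, B, hf⟩ := hX
  obtain ⟨k', a', b', c', d', e', D', A', B', hf'⟩ := hX'
  obtain ⟨⟩ := hf
  obtain ⟨⟩ := hf'
  obtain rfl : k = k' := by grind
  obtain rfl : D = D' := by grind
  obtain rfl : a = a' := by grind
  obtain rfl : b = b' := by grind
  obtain rfl : B = B' := by grind
  obtain rfl : d = d' := by grind
  obtain rfl : c = c' := by grind
  obtain rfl : A = A' := by grind
  obtain rfl : e = e' := by grind
  grind

/-- The fourth harmonic point depends at most on the first vertex `H` of the quadrangle. -/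
theorem IsHarmonic.eq_of_left (hH : FourthHarmonicLine Pt Ln) {h : Ln} {Z H G G' X X' X'' : Pt}
    (hX : IsHarmonic h Z H G X X') (hX' : IsHarmonic h Z H G' X X'') : X' = X'' := by
  by_cases hGG : G = G'
  · subst hGG; exact hX.unique hX'
  obtain ⟨k, a, b, c, d, e, D, A, B, hf⟩ := hX
  obtain ⟨k', a', b', c', d', e', D', A', B', hf'⟩ := hX'
  obtain ⟨⟩ := hf
  obtain ⟨⟩ := hf'
  obtain rfl : k = k' := by grind
  obtain rfl : D = D' := by grind
  obtain rfl : a = a' := by grind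
  have h1 : h ≠ a := by grind
  have h2 : b ≠ b' := by grind
  obtain ⟨m, m1, m2, m3⟩ := hH h a b b' k d' c' d c H X G G' D B B' Z A' A h1 ‹_› ‹_› ‹_›
    (by grind) h2 (by grind) (by grind) ‹_› ‹_› ‹_› (by grind) (by grind) ‹_› ‹_› ‹_› ‹_› ‹_›
    ‹_› ‹_› ‹_› ‹_› ‹_› ‹_› ‹_› ‹_› ‹_› ‹_› ‹_› ‹_› ‹_› ‹_› ‹_› ‹_› ‹_› ‹_› ‹_› ‹_›
  have h3 : m = e := by grind
  have h4 : m = e' := by grind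
  grind

theorem IsHarmonic.ne (hF : FanoLine Pt Ln) {h : Ln} {Z H G X X' : Pt}
    (hX : IsHarmonic h Z H G X X') : X' ≠ X := by
  rintro rfl
  obtain ⟨k, a, b, c, d, e, D, A, B, hf⟩ := hX
  obtain ⟨⟩ := hf
  have h1 : A ≠ B := by grind
  exact hF H G A B D X' Z h c e b a d k ‹_› h1 ‹_› ‹_› (by grind) (by grind) ‹_› ‹_› (by grind)
    (by grind) ‹_› ‹_› ‹_› ‹_› ‹_› ‹_› ‹_› ‹_› ‹_› ‹_› ‹_› ‹_› ‹_› ‹_› ‹_› ‹_› ‹_›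

/-- Where diagonal points are not collinear, every line has at least four points: the fourth
harmonic point of three points is a new one. -/
theorem exists_fourth (hF : FanoLine Pt Ln) {k : Ln} {D Z X : Pt} (hD : D ∈ k) (hZ : Z ∈ k)
    (hX : X ∈ k) (h1 : D ≠ Z) (h2 : D ≠ X) (h3 : Z ≠ X) :
    ∃ W ∈ k, W ≠ D ∧ W ≠ Z ∧ W ≠ X := by
  obtain ⟨H, hH⟩ := exists_not_mem (Pt := Pt) k
  obtain ⟨h, hDh, hHh⟩ := exists_join (Ln := Ln) D H
  obtain ⟨p, q, r, hp, hq, hr, hpq, hpr, hqr⟩ := exists_three (Pt := Pt) h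
  obtain ⟨G, hG, hGD, hGH⟩ : ∃ G ∈ h, G ≠ D ∧ G ≠ H := by
    by_contra! hcon
    have hor : ∀ x ∈ h, x = D ∨ x = H := fun x hx => or_iff_not_imp_left.2 (hcon x hx)
    have h4 := hor p hp
    have h5 := hor q hq
    have h6 := hor r hr
    grind
  obtain ⟨W, hW⟩ := exists_isHarmonic hHh hG (Ne.symm hGH) hH (by grind) (by grind) (by grind)
    h3.symm hZ hX
  have h4 := hW.ne hF
  obtain ⟨k', a, b, c, d, e, D', A, B, hf⟩ := hW
  have h5 := hf.notMem
  obtain ⟨⟩ := hf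
  exact ⟨W, by grind, by grind, h5.2, h4⟩

/-- The fourth harmonic point does not depend on the vertices of the quadrangle. To compare the
vertices `H` and `H'`, a further point `W` of the axis serves as the second vertex. -/
theorem IsHarmonic.eq (hH : FourthHarmonicLine Pt Ln) (hF : FanoLine Pt Ln) {h : Ln}
    {Z H G H' G' X X' X'' : Pt}
    (hX : IsHarmonic h Z H G X X') (hX' : IsHarmonic h Z H' G' X X'') : X' = X'' := by
  by_cases hHH : H = H'
  · subst hHH; exact hX.eq_of_left hH hX'
  have hX0 := hX
  have hX0' := hX'
  obtain ⟨k, a, b, c, d, e, D, A, B, hf⟩ := hX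
  obtain ⟨k', a', b', c', d', e', D', A', B', hf'⟩ := hX'
  have : k = k' := by obtain ⟨⟩ := hf; obtain ⟨⟩ := hf'; grind
  subst this
  obtain ⟨W, h1, h2, h3, h4⟩ := exists_fourth hF hf.D_h hf.H_h hf'.H_h
    (fun h0 => hf.H_k (h0 ▸ hf.D_k)) (fun h0 => hf'.H_k (h0 ▸ hf.D_k)) hHH
  have hWk : W ∉ k := by obtain ⟨⟩ := hf; grind
  obtain ⟨Y, hY⟩ := exists_isHarmonic hf.H_h h1 (Ne.symm h3) hf.H_k hWk hf.Z_h hf.X_h hf.X_ne_Z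
    hf.Z_k hf.X_k
  obtain ⟨Y', hY'⟩ := exists_isHarmonic hf'.H_h h1 (Ne.symm h4) hf'.H_k hWk hf.Z_h hf.X_h
    hf.X_ne_Z hf.Z_k hf.X_k
  -- the constructions from `W` invert both the one from `H` and the one from `H'`
  have h5 := hY.symm
  have hYn : Y ∉ h ∧ Y ≠ Z ∧ Y ∈ k := by
    obtain ⟨k', a', b', c', d', e', D', A', B', hf'⟩ := hY
    have := hf'.notMem
    refine ⟨this.1, this.2, ?_⟩
    clear hX0 hX0' hY' h5
    obtain ⟨⟩ := hf; obtain ⟨⟩ := hf'; grind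
  obtain ⟨V, hV⟩ := exists_isHarmonic h1 hf'.H_h h4 hWk hf'.H_k hf.Z_h hYn.1 hYn.2.1 hf.Z_k hYn.2.2
  have h6 : X = V := h5.eq_of_left hH hV
  subst h6
  rw [hX0.eq_of_left hH hY, hX0'.eq_of_left hH hV.symm]

/-- The line joining the fourth harmonic points of `X` and `Y` meets `X Y` on the axis. -/
theorem HarmonicFigure.line (hH : FourthHarmonicLine Pt Ln) (hF : FanoLine Pt Ln)
    {h k k' a a' b b' c c' d d' e e' m : Ln} {Z H X X' Y Y' D E A A' B B' D₁ E₁ : Pt}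
    (hX : HarmonicFigure h k a b c d e Z H E X X' D₁ A B)
    (hY : HarmonicFigure h k' a' b' c' d' e' Z H D Y Y' E₁ A' B')
    (hDk : D ∈ k) (hEk : E ∈ k') (hXm : X ∈ m) (hYm : Y ∈ m) (hHm : H ∈ m) : e = e' := by
  have hXX : X' ≠ X := IsHarmonic.ne hF ⟨_, _, _, _, _, _, _, _, _, hX⟩
  obtain ⟨⟩ := hX
  obtain ⟨⟩ := hY
  obtain rfl : D = D₁ := by grind
  obtain rfl : E = E₁ := by grind
  obtain rfl : a = a' := by grind
  obtain rfl : d = k' := by grind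
  obtain rfl : d' = k := by grind
  have hha : h ≠ a := by grind
  have hAh : A ∉ h := by grind
  have hAa : A ∉ a := by grind
  obtain ⟨g, hAg, hBg⟩ := exists_join (Ln := Ln) A B'
  obtain ⟨G, hGg, hGh⟩ := exists_meet (Pt := Pt) g h
  obtain ⟨n, hGn, hBn⟩ := exists_join (Ln := Ln) G B
  obtain ⟨Y₁, hY₁n, hY₁b⟩ := exists_meet (Pt := Pt) n b'
  have hdc : d ≠ c := by grind
  have hAY : A ≠ Y := by grind
  have hBB : B ≠ B' := by grind
  have hgc : g ≠ c := by grind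
  have hdg : d ≠ g := by grind
  have hHc : H ∉ c := by grind
  have hBH : B' ≠ H := by grind
  have hHg : H ∉ g := by grind
  obtain ⟨m', m1, m2, m3⟩ := hH h a d g c n b' b d' H A E G D Z B' B Y₁ X hha ‹_› ‹_› hAh
    hAa hdg hdc hgc ‹_› ‹_› ‹_› ‹_› hHg hHc ‹_› ‹_› ‹_› ‹_› ‹_› ‹_› ‹_› ‹_› ‹_› ‹_› ‹_› ‹_›
    ‹_› ‹_› ‹_› ‹_› ‹_› ‹_› ‹_› ‹_› ‹_› ‹_› ‹_› ‹_›
  have hmm : m = m' := by grind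
  have hYY : Y₁ = Y := by grind
  subst hmm hYY
  have hGD : G ≠ D := by grind
  have hYa : Y₁ ∉ a := by grind
  have hnd : n ≠ d := by grind
  have hnb : n ≠ b' := by grind
  have hdb : d ≠ b' := by grind
  obtain ⟨m', m4, m5, m6⟩ := hH h a n d b' c' d' g c H Y₁ G E D B Z B' A' A hha ‹_› ‹_› ‹_›
    hYa hnd hnb hdb ‹_› ‹_› ‹_› (by grind) (by grind) (by grind) ‹_› ‹_› ‹_› ‹_› ‹_› ‹_› ‹_› ‹_›
    ‹_› ‹_› ‹_› ‹_› ‹_› ‹_› ‹_› ‹_› ‹_› ‹_› ‹_› ‹_› ‹_› ‹_› ‹_› ‹_›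
  have h1 : m' = e := by grind
  have h2 : m' = e' := by grind
  rw [← h1, h2]

/-- Harmonic midpoints: `X` and `Y` are interchanged by the harmonic construction with a suitable
centre `M`. With `W = G X ∩ H Y` and `V = H X ∩ G Y`, it lies on `W V`. -/
theorem exists_isHarmonic_center (hH : FourthHarmonicLine Pt Ln) (hF : FanoLine Pt Ln) {h k : Ln}
    {X Y H G : Pt} (hXh : X ∉ h) (hYh : Y ∉ h) (hXY : X ≠ Y) (hXk : X ∈ k) (hYk : Y ∈ k)
    (hHh : H ∈ h) (hGh : G ∈ h) (hHG : H ≠ G) (hHk : H ∉ k) (hGk : G ∉ k) :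
    ∃ M ∈ k, M ∉ h ∧ M ≠ X ∧ IsHarmonic h M H G X Y := by
  obtain ⟨D, hDk, hDh⟩ := exists_meet (Pt := Pt) k h
  obtain ⟨b, hGb, hXb⟩ := exists_join (Ln := Ln) G X
  obtain ⟨e, hHe, hYe⟩ := exists_join (Ln := Ln) H Y
  obtain ⟨W, hWb, hWe⟩ := exists_meet (Pt := Pt) b e
  obtain ⟨s, hHs, hXs⟩ := exists_join (Ln := Ln) H X
  obtain ⟨t, hGt, hYt⟩ := exists_join (Ln := Ln) G Y
  obtain ⟨V, hVs, hVt⟩ := exists_meet (Pt := Pt) s t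
  obtain ⟨n, hWn, hVn⟩ := exists_join (Ln := Ln) W V
  obtain ⟨M, hMn, hMk⟩ := exists_meet (Pt := Pt) n k
  obtain ⟨a, hHa, hMa⟩ := exists_join (Ln := Ln) H M
  obtain ⟨B, hBa, hBb⟩ := exists_meet (Pt := Pt) a b
  obtain ⟨c, hDc, hBc⟩ := exists_join (Ln := Ln) D B
  obtain ⟨A, hAc, hAe⟩ := exists_meet (Pt := Pt) c e
  obtain ⟨d, hGd, hAd⟩ := exists_join (Ln := Ln) G A
  obtain ⟨M', hM'a, hM'd⟩ := exists_meet (Pt := Pt) a d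
  have hDn : D ∉ n := fun hD => hF X Y H G D V W k h s t b e n hXY hHG hXk hYk hHk hGk hHh hGh hXh
    hYh hXs hHs hYt hGt hXb hGb hYe hHe hDk hDh hVs hVt hWb hWe hD hVn hWn
  have hbe : b ≠ e := by grind
  have hst : s ≠ t := by grind
  have hDb : D ∉ b := by grind
  have hDe : D ∉ e := by grind
  have hWh : W ∉ h := by grind
  have hWk : W ∉ k := by grind
  have hVk : V ∉ k := by grind
  have hVh : V ∉ h := by grind
  have hMh : M ∉ h := by grind
  have hVb : V ∉ b := by grind
  have hVe : V ∉ e := by grind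
  have hMX : M ≠ X := by grind
  have hHn : H ∉ n := by grind
  have hck : c ≠ k := by grind
  have hch : c ≠ h := by grind
  have hWB : W ≠ B := by grind
  have hWc : W ∉ c := by grind
  obtain ⟨m, m1, m2, m3⟩ := hH b e k c h a d s t W D X B G Y A H M' V hbe hWb hWe hDb hDe hck.symm
    (by grind) hch hDk hDc hDh hWk hWc hWh hXk hXb hYk hYe hBc hBb hAc hAe hGh hGb hHh hHe hBa hHa
    hM'a hGd hAd hM'd hXs hHs hVs hGt hYt hVt
  obtain rfl : n = m := (eq_or_eq hVn hWn m2 m3).resolve_left (by grind)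
  have hMM : M' = M := (eq_or_eq hM'a hMa m1 hMn).resolve_right (by grind)
  subst hMM
  exact ⟨M', hMk, hMh, hMX, k, a, b, c, d, e, D, A, B, by
    constructor <;> first | assumption | exact hMX.symm⟩

/-- The centre of the harmonic construction interchanging `X` and `Y` is determined by `X`, `Y`
and the axis. -/
theorem IsHarmonic.center_unique (hH : FourthHarmonicLine Pt Ln) {h : Ln} {Z Z' H G X Y : Pt}
    (hXY : X ≠ Y) (hZ : IsHarmonic h Z H G X Y) (hZ' : IsHarmonic h Z' H G X Y) : Z = Z' := by
  obtain ⟨s, hHs, hXs⟩ := exists_join (Ln := Ln) H X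
  obtain ⟨t, hGt, hYt⟩ := exists_join (Ln := Ln) G Y
  obtain ⟨V, hVs, hVt⟩ := exists_meet (Pt := Pt) s t
  have key : ∀ {Z : Pt} {k a b c d e : Ln} {D A B W : Pt} {n : Ln},
      HarmonicFigure h k a b c d e Z H G X Y D A B → W ∈ b → W ∈ e → W ∈ n → V ∈ n → Z ∈ n := by
    intro Z k a b c d e D A B W n hf hWb hWe hWn hVn
    have hYn := hf.notMem
    obtain ⟨⟩ := hf
    have hbe : b ≠ e := by grind
    have hDb : D ∉ b := by grind
    have hDe : D ∉ e := by grind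
    have hWh : W ∉ h := by grind
    have hWk : W ∉ k := by grind
    have hck : k ≠ c := by grind
    have hkh : k ≠ h := by grind
    have hch : c ≠ h := by grind
    have hWB : W ≠ B := by grind
    have hWc : W ∉ c := by grind
    have hVW : V ≠ W := by grind
    obtain ⟨m, m1, m2, m3⟩ := hH b e k c h a d s t W D X B G Y A H Z V hbe hWb hWe hDb hDe hck
      hkh hch ‹_› ‹_› ‹_› hWk hWc hWh ‹_› ‹_› ‹_› ‹_› ‹_› ‹_› ‹_› ‹_› ‹_› ‹_› ‹_› ‹_› ‹_› ‹_› ‹_›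
      ‹_› ‹_› ‹_› ‹_› ‹_› ‹_› ‹_› ‹_› ‹_›
    grind
  obtain ⟨k, a, b, c, d, e, D, A, B, hf⟩ := hZ
  obtain ⟨k', a', b', c', d', e', D', A', B', hf'⟩ := hZ'
  obtain ⟨W, hWb, hWe⟩ := exists_meet (Pt := Pt) b e
  obtain ⟨n, hWn, hVn⟩ := exists_join (Ln := Ln) W V
  have hb : b = b' := by
    have := hf.X_b; have := hf.G_b; have := hf'.X_b; have := hf'.G_b
    have := hf.X_h; have := hf.G_h; grind
  have he : e = e' := by
    have := hf.X'_e; have := hf.H_e; have := hf'.X'_e; have := hf'.H_e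
    have := hf.notMem.1; have := hf.H_h; grind
  have h1 := key hf hWb hWe hWn hVn
  have h2 := key hf' (hb ▸ hWb) (he ▸ hWe) hWn hVn
  have h3 : X ∉ n ∨ Y ∉ n := by
    obtain ⟨⟩ := hf
    by_contra! hcon
    have : n = k := by grind
    grind
  have h4 := hf.Z_k
  have h5 := hf'.Z_k
  have h6 : k = k' := by
    have := hf.X_k; have := hf.X'_k; have := hf'.X_k; have := hf'.X'_k; grind
  have h7 := hf.X_k
  have h8 := hf.X'_k
  grind

open Classical in
/-- The harmonic homology with centre `Z` and axis `h`. -/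
noncomputable def harmonicMap (h : Ln) (Z X : Pt) : Pt :=
  if X ∈ h then X else if X = Z then Z
  else @Classical.epsilon Pt ⟨X⟩ fun X' => ∃ H G, IsHarmonic h Z H G X X'

theorem exists_two_of_mem {h : Ln} {D : Pt} : ∃ H ∈ h, ∃ G ∈ h, H ≠ D ∧ G ≠ D ∧ H ≠ G := by
  obtain ⟨p, q, r, hp, hq, hr, hpq, hpr, hqr⟩ := exists_three (Pt := Pt) h
  by_cases h1 : p = D
  · exact ⟨q, hq, r, hr, by grind, by grind, hqr⟩
  · by_cases h2 : q = D
    · exact ⟨p, hp, r, hr, h1, by grind, hpr⟩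
    · exact ⟨p, hp, q, hq, h1, h2, hpq⟩

section Map

variable (hH : FourthHarmonicLine Pt Ln) (hF : FanoLine Pt Ln)

include hH hF

theorem IsHarmonic.harmonicMap_eq {h : Ln} {Z H G X X' : Pt} (hX : IsHarmonic h Z H G X X') :
    harmonicMap h Z X = X' := by
  obtain ⟨h1, h2⟩ : X ∉ h ∧ X ≠ Z := by
    obtain ⟨k, a, b, c, d, e, D, A, B, hf⟩ := hX
    exact ⟨hf.X_h, hf.X_ne_Z⟩
  rw [harmonicMap, if_neg h1, if_neg h2]
  have h3 : ∃ X', ∃ H G, IsHarmonic h Z H G X X' := ⟨X', H, G, hX⟩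
  obtain ⟨H', G', h4⟩ := @Classical.epsilon_spec _ _ h3
  exact h4.eq hH hF hX

theorem harmonicMap_spec {h k : Ln} {Z X : Pt} (hZ : Z ∉ h) (hX : X ∉ h) (hXZ : X ≠ Z)
    (hZk : Z ∈ k) (hXk : X ∈ k) {H G : Pt} (hHh : H ∈ h) (hGh : G ∈ h) (hHG : H ≠ G)
    (hHk : H ∉ k) (hGk : G ∉ k) : IsHarmonic h Z H G X (harmonicMap h Z X) := by
  obtain ⟨X', hX'⟩ := exists_isHarmonic hHh hGh hHG hHk hGk hZ hX hXZ hZk hXk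
  rwa [hX'.harmonicMap_eq hH hF]

theorem harmonicMap_involutive {h : Ln} {Z : Pt} (hZ : Z ∉ h) :
    Function.Involutive (harmonicMap h Z) := by
  intro X
  by_cases hX : X ∈ h
  · simp [harmonicMap, hX]
  by_cases hXZ : X = Z
  · simp [harmonicMap, hXZ, hZ]
  obtain ⟨k, hZk, hXk⟩ := exists_join (Ln := Ln) Z X
  obtain ⟨D, hDk, hDh⟩ := exists_meet (Pt := Pt) k h
  obtain ⟨H, hHh, G, hGh, h1, h2, h3⟩ := exists_two_of_mem (h := h) (D := D)
  exact (harmonicMap_spec hH hF hZ hX hXZ hZk hXk hHh hGh h3 (by grind)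
    (by grind)).symm.harmonicMap_eq hH hF

theorem harmonicMap_mem {h k : Ln} {Z X : Pt} (hZ : Z ∉ h) (hZk : Z ∈ k) (hXk : X ∈ k) :
    harmonicMap h Z X ∈ k := by
  by_cases hX : X ∈ h
  · simpa [harmonicMap, hX]
  by_cases hXZ : X = Z
  · simpa [harmonicMap, hXZ, hZ]
  obtain ⟨D, hDk, hDh⟩ := exists_meet (Pt := Pt) k h
  obtain ⟨H, hHh, G, hGh, h1, h2, h3⟩ := exists_two_of_mem (h := h) (D := D)
  obtain ⟨k', a, b, c, d, e, D', A, B, hf⟩ := harmonicMap_spec hH hF hZ hX hXZ hZk hXk hHh hGh h3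
    (by grind) (by grind)
  have h4 := hf.Z_k
  have h5 := hf.X_k
  have h6 := hf.X'_k
  grind

theorem harmonicMap_notMem {h : Ln} {Z X : Pt} (hZ : Z ∉ h) (hX : X ∉ h) :
    harmonicMap h Z X ∉ h := by
  intro h1
  have h2 := harmonicMap_involutive hH hF hZ X
  have h3 : harmonicMap h Z (harmonicMap h Z X) = harmonicMap h Z X := if_pos h1
  rw [h3] at h2
  exact hX (h2 ▸ h1)

/-- The harmonic construction is a homology with axis `h`. -/
theorem isAxial_harmonicMap {h : Ln} {Z : Pt} (hZ : Z ∉ h) : IsAxial h (harmonicMap h Z) where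
  fix hp := if_pos hp
  off hp := harmonicMap_notMem hH hF hZ hp
  line {X Y H m} hX hY hHh hHm hXm hYm := by
    by_cases hZm : Z ∈ m
    · exact ⟨m, hHm, harmonicMap_mem hH hF hZ hZm hXm, harmonicMap_mem hH hF hZ hZm hYm⟩
    by_cases hXY : X = Y
    · subst hXY
      obtain ⟨l, h1, h2⟩ := exists_join (Ln := Ln) H (harmonicMap h Z X)
      exact ⟨l, h1, h2, h2⟩
    obtain ⟨k, hZk, hXk⟩ := exists_join (Ln := Ln) Z X
    obtain ⟨k', hZk', hYk'⟩ := exists_join (Ln := Ln) Z Y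
    obtain ⟨D, hDk, hDh⟩ := exists_meet (Pt := Pt) k h
    obtain ⟨E, hEk, hEh⟩ := exists_meet (Pt := Pt) k' h
    have hXZ : X ≠ Z := by grind
    have hYZ : Y ≠ Z := by grind
    have hkk : k ≠ k' := by grind
    have hHk : H ∉ k := by grind
    have hHk' : H ∉ k' := by grind
    obtain ⟨l, a, b, c, d, e, D', A, B, hf⟩ := harmonicMap_spec hH hF hZ hX hXZ hZk hXk hHh hEh
      (by grind) hHk (by grind)
    obtain ⟨l', a', b', c', d', e', E', A', B', hf'⟩ := harmonicMap_spec hH hF hZ hY hYZ hZk' hYk'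
      hHh hDh (by grind) hHk' (by grind)
    have h1 : D ∈ l := by have := hf.Z_k; have := hf.X_k; grind
    have h2 : E ∈ l' := by have := hf'.Z_k; have := hf'.X_k; grind
    have h3 := hf.line hH hF hf' h1 h2 hXm hYm hHm
    subst h3
    exact ⟨e, hf.H_e, hf.X'_e, hf'.X'_e⟩

/-- The harmonic homology with centre `Z` and axis `h`, as a permutation of the points. -/
noncomputable def harmonicPerm {h : Ln} {Z : Pt} (hZ : Z ∉ h) : Equiv.Perm Pt :=
  (harmonicMap_involutive hH hF hZ).toPerm

/-- The product of the harmonic homologies whose centres are `X` and the harmonic midpoint of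
`X`, `Y` is the elation sending `X` to `Y`. -/
theorem FourthHarmonicLine.hasElations : HasElations Pt Ln := by
  intro h X Y hXh hYh
  by_cases hXY : X = Y
  · subst hXY
    obtain ⟨Z, -, -, hZ, -⟩ := exists_three (Pt := Pt) h
    exact ⟨1, ⟨IsAxial.id h, Z, hZ, fun _ _ _ hp => hp⟩, rfl⟩
  obtain ⟨k, hXk, hYk⟩ := exists_join (Ln := Ln) X Y
  obtain ⟨D, hDk, hDh⟩ := exists_meet (Pt := Pt) k h
  obtain ⟨H, hHh, G, hGh, h1, h2, h3⟩ := exists_two_of_mem (h := h) (D := D)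
  obtain ⟨M, hMk, hMh, hMX, hM⟩ := exists_isHarmonic_center hH hF hXh hYh hXY hXk hYk hHh hGh h3
    (by grind) (by grind)
  set f := harmonicPerm hH hF hXh
  set g := harmonicPerm hH hF hMh
  have hfX : f X = X := by
    change harmonicMap h X X = X
    simp [harmonicMap, hXh]
  have hgX : g X = Y := hM.harmonicMap_eq hH hF
  have hax : IsAxial h (g * f : Equiv.Perm Pt) :=
    (isAxial_harmonicMap hH hF hMh).comp (isAxial_harmonicMap hH hF hXh)
  refine ⟨g * f, ⟨hax, hax.exists_center fun P hP hfix => ?_⟩, by simp [hfX, hgX]⟩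
  -- a fixed point off the axis would have two harmonic midpoints with its image
  have hgf : harmonicMap h M (harmonicMap h X P) = P := hfix
  have hPX : P ≠ X := by
    rintro rfl
    rw [show harmonicMap h P P = P from hfX] at hgf
    exact hXY (hgf.symm.trans hgX)
  have hgP : harmonicMap h M P = harmonicMap h X P := by
    conv_lhs => rw [← hgf]
    exact harmonicMap_involutive hH hF hMh _
  obtain ⟨m, hXm, hPm⟩ := exists_join (Ln := Ln) X P
  obtain ⟨D', hDm, hDh'⟩ := exists_meet (Pt := Pt) m h
  obtain ⟨H', hHh', G', hGh', h4, h5, h6⟩ := exists_two_of_mem (h := h) (D := D')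
  have hHm : H' ∉ m := by grind
  have hGm : G' ∉ m := by grind
  have hfP := harmonicMap_spec hH hF hXh hP hPX hXm hPm hHh' hGh' h6 hHm hGm
  have hne := hfP.ne hF
  have hPM : P ≠ M := by
    rintro rfl
    rw [← hgP] at hne
    exact hne (by simp [harmonicMap, hMh])
  obtain ⟨m', hMm', hPm'⟩ := exists_join (Ln := Ln) M P
  have h7 := harmonicMap_mem hH hF hXh hXm hPm
  have h8 := harmonicMap_mem hH hF hMh hMm' hPm'
  rw [hgP] at h8
  have hmm : m = m' := by grind
  subst hmm
  have hgP' := harmonicMap_spec hH hF hMh hP hPM hMm' hPm hHh' hGh' h6 hHm hGm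
  rw [hgP] at hgP'
  exact hMX (hfP.center_unique hH hne.symm hgP').symm

end Map

end Harmonic

/-! ### The projective closure of an affine plane -/

section Closure

variable {P L : Type*} [Membership P L]

theorem Parallel.refl (l : L) : Parallel (P := P) l l := Or.inl rfl

theorem Parallel.symm {l m : L} (h : Parallel (P := P) l m) : Parallel (P := P) m l :=
  h.imp Eq.symm fun h p hp => h p hp.symm

theorem Parallel.eq_of_mem {l m : L} (h : Parallel (P := P) l m) {p : P} (hl : p ∈ l)
    (hm : p ∈ m) : l = m :=
  h.resolve_right fun h => h p ⟨hl, hm⟩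

theorem Parallel.trans [IsAffinePlane P L] {l m n : L} (h : Parallel (P := P) l m)
    (h' : Parallel (P := P) m n) : Parallel (P := P) l n := by
  refine or_iff_not_imp_right.2 fun hp => ?_
  push Not at hp
  obtain ⟨p, hl, hn⟩ := hp
  exact (IsAffinePlane.existsUnique_parallel p m).unique ⟨hl, h⟩ ⟨hn, h'.symm⟩

theorem exists_parallel [IsAffinePlane P L] (p : P) (l : L) :
    ∃ m : L, p ∈ m ∧ Parallel (P := P) m l :=
  (IsAffinePlane.existsUnique_parallel p l).exists

instance projMembership : Membership (ProjPoint P L) (ProjLine P L) :=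
  ⟨fun l p => ProjIncident p l⟩

/-- The ideal point of a line. -/
def idealPt (l : L) : ProjPoint P L := .ideal ⟨{m | Parallel m l}, l, rfl⟩

theorem ProjPoint.proper_or_ideal (A : ProjPoint P L) :
    (∃ p, A = .proper p) ∨ ∃ l, A = idealPt l := by
  rcases A with p | ⟨c, l, rfl⟩
  · exact Or.inl ⟨p, rfl⟩
  · exact Or.inr ⟨l, rfl⟩

theorem proper_mem_proper {p : P} {l : L} :
    (ProjPoint.proper p : ProjPoint P L) ∈ ProjLine.proper l ↔ p ∈ l := Iff.rfl

theorem proper_notMem_atInfinity {p : P} :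
    (ProjPoint.proper p : ProjPoint P L) ∉ (ProjLine.atInfinity : ProjLine P L) := fun h => h

theorem idealPt_mem_proper {l m : L} :
    (idealPt l : ProjPoint P L) ∈ ProjLine.proper m ↔ Parallel (P := P) m l := Iff.rfl

theorem idealPt_mem_atInfinity {l : L} :
    (idealPt l : ProjPoint P L) ∈ (ProjLine.atInfinity : ProjLine P L) := trivial

theorem exists_idealPt {A : ProjPoint P L} (h : A ∈ (ProjLine.atInfinity : ProjLine P L)) :
    ∃ l, A = idealPt l := by
  rcases A.proper_or_ideal with ⟨p, rfl⟩ | h'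
  · exact h.elim
  · exact h'

theorem exists_proper {A : ProjPoint P L} (h : A ∉ (ProjLine.atInfinity : ProjLine P L)) :
    ∃ p, A = .proper p := by
  rcases A.proper_or_ideal with h' | ⟨l, rfl⟩
  · exact h'
  · exact (h trivial).elim

variable [IsAffinePlane P L]

theorem idealPt_eq {l m : L} : (idealPt l : ProjPoint P L) = idealPt m ↔ Parallel (P := P) l m := by
  constructor
  · intro h
    exact idealPt_mem_proper.1 (h ▸ idealPt_mem_proper.2 (Parallel.refl l))
  · intro h
    simp only [idealPt, ProjPoint.ideal.injEq, Subtype.mk.injEq]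
    ext n
    exact ⟨fun hn => hn.trans h, fun hn => hn.trans h.symm⟩

theorem exists_mem_mem [Nonempty L] (p q : P) : ∃ l : L, p ∈ l ∧ q ∈ l := by
  by_cases hpq : p = q
  · subst hpq
    obtain ⟨l, hl, -⟩ := exists_parallel p (Classical.arbitrary L)
    exact ⟨l, hl, hl⟩
  · exact IsAffinePlane.exists_line p q hpq

instance closure_isProjectivePlane [Nonempty L] :
    IsProjectivePlane (ProjPoint P L) (ProjLine P L) where
  exists_join A B := by
    rcases A.proper_or_ideal with ⟨p, rfl⟩ | ⟨l, rfl⟩ <;>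
      rcases B.proper_or_ideal with ⟨q, rfl⟩ | ⟨m, rfl⟩
    · obtain ⟨l, h⟩ := exists_mem_mem (L := L) p q
      exact ⟨.proper l, h⟩
    · obtain ⟨l, h⟩ := exists_parallel p m
      exact ⟨.proper l, h⟩
    · obtain ⟨m, h⟩ := exists_parallel q l
      exact ⟨.proper m, h.symm⟩
    · exact ⟨.atInfinity, trivial, trivial⟩
  exists_meet l m := by
    rcases l with l | _ <;> rcases m with m | _
    · by_cases h : Parallel (P := P) l m
      · exact ⟨idealPt l, idealPt_mem_proper.2 (Parallel.refl l), idealPt_mem_proper.2 h.symm⟩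
      · simp only [Parallel, not_or, not_forall, not_not] at h
        obtain ⟨-, p, hp⟩ := h
        exact ⟨.proper p, hp⟩
    · exact ⟨idealPt l, idealPt_mem_proper.2 (Parallel.refl l), trivial⟩
    · exact ⟨idealPt m, trivial, idealPt_mem_proper.2 (Parallel.refl m)⟩
    · exact ⟨idealPt (Classical.arbitrary L), trivial, trivial⟩
  eq_or_eq {A B l m} hAl hBl hAm hBm := by
    rcases l with l | _ <;> rcases m with m | _
    · rcases A.proper_or_ideal with ⟨p, rfl⟩ | ⟨a, rfl⟩ <;>
        rcases B.proper_or_ideal with ⟨q, rfl⟩ | ⟨b, rfl⟩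
      · by_cases hpq : p = q
        · exact Or.inl (by rw [hpq])
        · exact Or.inr (by rw [IsAffinePlane.line_unique p q l m hpq hAl hBl hAm hBm])
      · exact Or.inr (congrArg _ ((Parallel.trans (idealPt_mem_proper.1 hBl)
          (idealPt_mem_proper.1 hBm).symm).eq_of_mem (p := p) hAl hAm))
      · exact Or.inr (congrArg _ ((Parallel.trans (idealPt_mem_proper.1 hAl)
          (idealPt_mem_proper.1 hAm).symm).eq_of_mem (p := q) hBl hBm))
      · exact Or.inl (idealPt_eq.2 ((idealPt_mem_proper.1 hAl).symm.trans
          (idealPt_mem_proper.1 hBl)))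
    · obtain ⟨a, rfl⟩ := exists_idealPt hAm
      obtain ⟨b, rfl⟩ := exists_idealPt hBm
      exact Or.inl (idealPt_eq.2 ((idealPt_mem_proper.1 hAl).symm.trans
          (idealPt_mem_proper.1 hBl)))
    · obtain ⟨a, rfl⟩ := exists_idealPt hAl
      obtain ⟨b, rfl⟩ := exists_idealPt hBl
      exact Or.inl (idealPt_eq.2 ((idealPt_mem_proper.1 hAm).symm.trans
          (idealPt_mem_proper.1 hBm)))
    · exact Or.inr rfl
  exists_three l := by
    rcases l with l | _
    · obtain ⟨p, q, hpq, hp, hq⟩ := IsAffinePlane.two_points (P := P) l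
      refine ⟨.proper p, .proper q, idealPt l, hp, hq, idealPt_mem_proper.2 (Parallel.refl l), ?_,
        ?_, ?_⟩
      · simpa using hpq
      · exact fun h => by cases h
      · exact fun h => by cases h
    · obtain ⟨p, q, r, h⟩ := IsAffinePlane.three_points (P := P) (L := L)
      obtain ⟨a, ap, aq⟩ := exists_mem_mem (L := L) p q
      obtain ⟨b, bp, br⟩ := exists_mem_mem (L := L) p r
      obtain ⟨c, cq, cr⟩ := exists_mem_mem (L := L) q r
      refine ⟨idealPt a, idealPt b, idealPt c, trivial, trivial, trivial, fun h' => h ?_,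
        fun h' => h ?_, fun h' => h ?_⟩
      · have := (idealPt_eq.1 h').eq_of_mem (p := p) ap bp
        exact ⟨a, ap, aq, this ▸ br⟩
      · have := (idealPt_eq.1 h').eq_of_mem (p := q) aq cq
        exact ⟨a, ap, aq, this ▸ cr⟩
      · have := (idealPt_eq.1 h').eq_of_mem (p := r) br cr
        exact ⟨b, bp, this ▸ cq, br⟩
  exists_not_mem l := by
    obtain ⟨p, q, r, h⟩ := IsAffinePlane.three_points (P := P) (L := L)
    rcases l with l | _
    · by_contra! hcon
      exact h ⟨l, hcon (.proper p), hcon (.proper q), hcon (.proper r)⟩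
    · exact ⟨.proper p, fun h => h⟩

theorem mem_of_col [Nonempty L] {A B C : ProjPoint P L} {l : ProjLine P L} (h : Col A B C)
    (hBC : B ≠ C) (hB : B ∈ l) (hC : C ∈ l) : A ∈ l := by
  obtain ⟨m, hA, hB', hC'⟩ := h
  exact ((IsProjectivePlane.eq_or_eq hB hC hB' hC').resolve_left hBC) ▸ hA

theorem not_col [Nonempty L] {A B C : ProjPoint P L} {l : ProjLine P L} (hAB : A ≠ B) (hA : A ∈ l)
    (hB : B ∈ l) (hC : C ∉ l) : ¬ Col A B C := by
  rintro ⟨m, hA', hB', hC'⟩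
  exact hC ((IsProjectivePlane.eq_or_eq hA hB hA' hB').resolve_left hAB ▸ hC')

theorem DiagonalPointsNotCollinear.fanoLine [Nonempty L] (h : DiagonalPointsNotCollinear P L) :
    FanoLine (ProjPoint P L) (ProjLine P L) := by
  intro A B C D X Y Z ab cd ac bd ad bc k hAB hCD hA hB hC hD hC' hD' hA' hB' a1 a2 b1 b2 c1 c2
    d1 d2 x1 x2 y1 y2 z1 z2 hX hY hZ
  refine h A B C D X Y Z (not_col hAB hA hB hC) (not_col hAB hA hB hD) ?_ ?_ ⟨ab, x1, hA, hB⟩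
    ⟨cd, x2, hC', hD'⟩ ⟨ac, y1, a1, a2⟩ ⟨bd, y2, b1, b2⟩ ⟨ad, z1, c1, c2⟩ ⟨bc, z2, d1, d2⟩
    ⟨k, hX, hY, hZ⟩
  · rintro ⟨m, m1, m2, m3⟩
    exact not_col hCD hC' hD' hA' ⟨m, m2, m3, m1⟩
  · rintro ⟨m, m1, m2, m3⟩
    exact not_col hCD hC' hD' hB' ⟨m, m2, m3, m1⟩

/-- The first case of `D₂`, for the triangles `P₁ P₂ Q₃` and `Q₁ Q₂ P₃`, each of which has a vertex
on a side of the other. -/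
theorem DesarguesTwo.fourthHarmonicLine [Nonempty L] (h : DesarguesTwo P L) :
    FourthHarmonicLine (ProjPoint P L) (ProjLine P L) := by
  intro l l' n₁ n₂ n₃ s s' t t' C O P₁ P₂ P₃ Q₁ Q₂ Q₃ A B hll hCl hCl' hOl hOl' h12 h13 h23
    hO1 hO2 hO3 hC1 hC2 hC3 p1 p1' q1 q1' p2 p2' q2 q2' p3 p3' q3 q3' s1 s2 s3 s4 s5 s6
    t1 t2 t3 t4 t5 t6
  have hP12 : P₁ ≠ P₂ := by grind
  have hQ12 : Q₁ ≠ Q₂ := by grind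
  have hP13 : P₁ ≠ P₃ := by grind
  have hP23 : P₂ ≠ P₃ := by grind
  have hQ13 : Q₁ ≠ Q₃ := by grind
  have hQ23 : Q₂ ≠ Q₃ := by grind
  have hP3 : P₃ ∉ l' := by grind
  have hQ3 : Q₃ ∉ l := by grind
  have hP2 : P₂ ∉ l' := by grind
  have hP1 : P₁ ∉ l' := by grind
  have hPQ1 : P₁ ≠ Q₃ := fun h => hQ3 (h ▸ p1')
  have hPQ2 : P₂ ≠ Q₃ := fun h => hQ3 (h ▸ p2')
  have hQP1 : Q₁ ≠ P₃ := fun h => hP3 (h ▸ q1')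
  have hQP2 : Q₂ ≠ P₃ := fun h => hP3 (h ▸ q2')
  have hss : s ≠ s' := by grind
  have htt : t ≠ t' := by grind
  have key := (h ![P₁, P₂, Q₃] ![Q₁, Q₂, P₃] ⟨not_col hP12 p1' p2' hQ3, not_col hQ12 q1' q2' hP3,
    ?_, ?_⟩ (Or.inl ⟨⟨l', q3', q1', q2'⟩, ⟨l, p3', p1', p2'⟩⟩)).1
    ⟨O, ?_⟩
  · obtain ⟨A', B', C', ⟨a1, a2⟩, ⟨b1, b2⟩, ⟨c1, c2⟩, k, k1, k2, k3⟩ := key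
    change Col A' P₂ Q₃ at a1
    change Col A' Q₂ P₃ at a2
    change Col B' P₁ Q₃ at b1
    change Col B' Q₁ P₃ at b2
    change Col C' P₁ P₂ at c1
    change Col C' Q₁ Q₂ at c2
    have hA : A' = A := (IsProjectivePlane.eq_or_eq (mem_of_col a1 hPQ2 s1 s2) s3
      (mem_of_col a2 hQP2 s5 s4) s6).resolve_right hss
    have hB : B' = B := (IsProjectivePlane.eq_or_eq (mem_of_col b1 hPQ1 t1 t2) t3
      (mem_of_col b2 hQP1 t5 t4) t6).resolve_right htt
    have hC : C' = C := (IsProjectivePlane.eq_or_eq (mem_of_col c1 hP12 p1' p2') hCl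
      (mem_of_col c2 hQ12 q1' q2') hCl').resolve_right hll
    exact ⟨k, hA ▸ k1, hB ▸ k2, hC ▸ k3⟩
  · intro i
    fin_cases i
    · exact fun h => hP1 ((show P₁ = Q₁ from h) ▸ q1')
    · exact fun h => hP2 ((show P₂ = Q₂ from h) ▸ q2')
    · exact fun h => hQ3 ((show Q₃ = P₃ from h) ▸ p3')
  · have d1 : ¬ ∃ m : ProjLine P L, P₁ ∈ m ∧ P₂ ∈ m ∧ Q₁ ∈ m ∧ Q₂ ∈ m := by grind
    have d2 : ¬ ∃ m : ProjLine P L, P₁ ∈ m ∧ Q₃ ∈ m ∧ Q₁ ∈ m ∧ P₃ ∈ m := by grind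
    have d3 : ¬ ∃ m : ProjLine P L, P₂ ∈ m ∧ Q₃ ∈ m ∧ Q₂ ∈ m ∧ P₃ ∈ m := by grind
    intro i j hij
    fin_cases i <;> fin_cases j
    · exact (hij rfl).elim
    · exact d1
    · exact d2
    · rintro ⟨m, m1, m2, m3, m4⟩; exact d1 ⟨m, m2, m1, m4, m3⟩
    · exact (hij rfl).elim
    · exact d3
    · rintro ⟨m, m1, m2, m3, m4⟩; exact d2 ⟨m, m2, m1, m4, m3⟩
    · rintro ⟨m, m1, m2, m3, m4⟩; exact d3 ⟨m, m2, m1, m4, m3⟩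
    · exact (hij rfl).elim
  · intro i
    fin_cases i
    · exact ⟨n₁, hO1, p1, q1⟩
    · exact ⟨n₂, hO2, p2, q2⟩
    · exact ⟨n₃, hO3, q3, p3⟩

theorem LittleDesargues.littleDesarguesLine [Nonempty L] (h : LittleDesargues P L) :
    LittleDesarguesLine (ProjPoint P L) (ProjLine P L) := by
  intro h₀ k m n Z X X' Y Y' W W' D E a a' b b' c hZ hZk hZm hZn hXk hX'k hYm hY'm hWn hW'n
    hX hX' hY hY' hW hW' hkm hkn hmn hXX hD hE a1 a2 a3 a4 a5 a6 b1 b2 b3 b4 b5 b6 hDE hYc hWc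
  have hYY : Y ≠ Y' := by grind
  have hWW : W ≠ W' := by grind
  have hXY : X ≠ Y := by grind
  have hXW : X ≠ W := by grind
  have hYW : Y ≠ W := by grind
  have hXY' : X' ≠ Y' := by grind
  have hXW' : X' ≠ W' := by grind
  have hYW' : Y' ≠ W' := by grind
  have hWa : W ∉ a := by grind
  have hWa' : W' ∉ a' := by grind
  have key := (h ![X, Y, W] ![X', Y', W'] ⟨not_col hXY a2 a3 hWa, not_col hXY' a5 a6 hWa', ?_, ?_⟩
    Z E D ⟨k, hZk, hXk, hX'k⟩ ⟨m, hZm, hYm, hY'm⟩ ⟨⟨b, b1, b2, b3⟩, ⟨b', b4, b5, b6⟩⟩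
    ⟨⟨a, a1, a2, a3⟩, ⟨a', a4, a5, a6⟩⟩ ⟨h₀, hZ, hE, hD⟩).1 ⟨n, hZn, hWn, hW'n⟩
  · obtain ⟨F, ⟨f1, f2⟩, f3⟩ := key
    change Col F Y W at f1
    change Col F Y' W' at f2
    obtain ⟨c', c1, c2, c3⟩ := f2
    exact ⟨F, mem_of_col f3 hDE.symm hE hD, mem_of_col f1 hYW hYc hWc, c', c1, c2, c3⟩
  · intro i
    fin_cases i
    · exact hXX
    · exact hYY
    · exact hWW
  · have d1 : ¬ ∃ m : ProjLine P L, X ∈ m ∧ Y ∈ m ∧ X' ∈ m ∧ Y' ∈ m := by grind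
    have d2 : ¬ ∃ m : ProjLine P L, X ∈ m ∧ W ∈ m ∧ X' ∈ m ∧ W' ∈ m := by grind
    have d3 : ¬ ∃ m : ProjLine P L, Y ∈ m ∧ W ∈ m ∧ Y' ∈ m ∧ W' ∈ m := by grind
    intro i j hij
    fin_cases i <;> fin_cases j
    · exact (hij rfl).elim
    · exact d1
    · exact d2
    · rintro ⟨m, m1, m2, m3, m4⟩; exact d1 ⟨m, m2, m1, m4, m3⟩
    · exact (hij rfl).elim
    · exact d3
    · rintro ⟨m, m1, m2, m3, m4⟩; exact d2 ⟨m, m2, m1, m4, m3⟩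
    · rintro ⟨m, m1, m2, m3, m4⟩; exact d3 ⟨m, m2, m1, m4, m3⟩
    · exact (hij rfl).elim

/-! ### The translation group -/

omit [IsAffinePlane P L] in
theorem IsAxial.exists_proper {f : ProjPoint P L → ProjPoint P L}
    (hf : IsAxial (ProjLine.atInfinity : ProjLine P L) f) (p : P) :
    ∃ q, f (.proper p) = .proper q :=
  _root_.exists_proper (hf.off proper_notMem_atInfinity)

theorem IsAxial.exists_parallel [Nonempty L] {f : Equiv.Perm (ProjPoint P L)}
    (hf : IsAxial (ProjLine.atInfinity : ProjLine P L) f) (l : L) :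
    ∃ m : L, Parallel (P := P) m l ∧ ∀ p : P, p ∈ l ↔ f (.proper p) ∈ ProjLine.proper m := by
  obtain ⟨m, hm1, hm2⟩ := hf.exists_line (.proper l)
  rcases m with m | _
  · exact ⟨m, hm1 (idealPt l) trivial (idealPt_mem_proper.2 (Parallel.refl l)),
      fun p => hm2 (.proper p)⟩
  · obtain ⟨p, -, -, hp, -⟩ := IsAffinePlane.two_points (P := P) l
    exact (hf.off (proper_notMem_atInfinity (p := p)) ((hm2 (.proper p)).1 hp)).elim

/-- The elations whose axis is the line at infinity make the points an abelian group with any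
given point as zero, such that all translates of lines are parallel lines. -/
theorem exists_addCommGroup [Nonempty L] (hE : HasElations (ProjPoint P L) (ProjLine P L))
    (O : P) : ∃ _ : AddCommGroup P, (0 : P) = O ∧
      ∀ (p : P) (l : L), ∃ m : L, Parallel (P := P) m l ∧ ∀ q, q ∈ l ↔ p + q ∈ m := by
  choose τ hτ hτO using fun p : P => hE .atInfinity (.proper O) (.proper p)
    proper_notMem_atInfinity proper_notMem_atInfinity
  choose add hadd using fun p q => (hτ p).1.exists_proper q
  choose neg hneg using fun p => (hτ p).symm.1.exists_proper O
  have hinj : ∀ {p q : P}, (ProjPoint.proper p : ProjPoint P L) = .proper q → p = q :=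
    fun h => ProjPoint.proper.inj h
  have hmul : ∀ p q, τ (add p q) = τ p * τ q := fun p q =>
    (hτ _).ext ((hτ p).mul (hτ q)) proper_notMem_atInfinity
      (show τ (add p q) (.proper O) = _ by rw [hτO, Equiv.Perm.mul_apply, hτO, hadd])
  have hone : τ O = 1 := (hτ O).eq_one proper_notMem_atInfinity (hτO O)
  let : Zero P := ⟨O⟩
  let : Add P := ⟨add⟩
  let : Neg P := ⟨neg⟩
  refine ⟨{ AddGroup.ofLeftAxioms (fun p q r => hinj ?_) (fun p => hinj ?_)
    (fun p => hinj ?_) with add_comm := fun p q => hinj ?_ }, rfl, fun p l => ?_⟩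
  · change ProjPoint.proper (add (add p q) r) = ProjPoint.proper (add p (add q r))
    rw [← hadd, ← hadd, hmul, Equiv.Perm.mul_apply, hadd q r]
  · change ProjPoint.proper (add O p) = _
    rw [← hadd, hone]; rfl
  · change ProjPoint.proper (add (neg p) p) = ProjPoint.proper O
    have h1 : τ (neg p) = (τ p).symm :=
      (hτ _).ext (hτ p).symm proper_notMem_atInfinity (by rw [hτO, hneg])
    rw [← hadd, h1, Equiv.symm_apply_eq, hτO]
  · change ProjPoint.proper (add p q) = ProjPoint.proper (add q p)
    have h1 : τ (add p q) = τ (add q p) := by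
      rw [hmul, hmul, (hτ p).commute hE (hτ q)]
    rw [← hτO (add p q), ← hτO (add q p), h1]
  · obtain ⟨m, hm1, hm2⟩ := (hτ p).1.exists_parallel l
    refine ⟨m, hm1, fun q => ?_⟩
    change _ ↔ add p q ∈ m
    rw [hm2, hadd, proper_mem_proper]

end Closure

/-! ### Translation planes and the segment calculus -/

/-- The points form a group such that the translates of each line are lines parallel to it. -/
class HasTranslations (P L : Type*) [Membership P L] [AddCommGroup P] : Prop where
  exists_translate : ∀ (p : P) (l : L), ∃ m : L, Parallel (P := P) m l ∧ ∀ q, q ∈ l ↔ p + q ∈ m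

section Translations

variable {P L : Type*} [Membership P L] [IsAffinePlane P L] [AddCommGroup P]

omit [IsAffinePlane P L] [AddCommGroup P] in
theorem exists_common {l m : L} (h : ¬ Parallel (P := P) l m) : ∃ p : P, p ∈ l ∧ p ∈ m := by
  simp only [Parallel, not_or, not_forall, not_not] at h
  exact h.2

theorem eq_zero_of_mem {S T : L} (hS : (0 : P) ∈ S) (hT : (0 : P) ∈ T) (hST : S ≠ T) {p : P}
    (hpS : p ∈ S) (hpT : p ∈ T) : p = 0 := by
  by_contra hp
  exact hST (IsAffinePlane.line_unique p 0 S T hp hpS hS hpT hT)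

/-- The line through `0` and `v`. -/
noncomputable def dirLine [Nonempty L] (v : P) : L := (exists_mem_mem (L := L) 0 v).choose

theorem zero_mem_dirLine [Nonempty L] (v : P) : (0 : P) ∈ (dirLine v : L) :=
  (exists_mem_mem (L := L) 0 v).choose_spec.1

theorem mem_dirLine [Nonempty L] (v : P) : v ∈ (dirLine v : L) :=
  (exists_mem_mem (L := L) 0 v).choose_spec.2

variable [HasTranslations P L]

/-- Lines are the cosets of the lines through `0`. -/
theorem mem_iff_sub_mem {S l : L} (hS : (0 : P) ∈ S) (hSl : Parallel (P := P) S l) {p q : P}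
    (hp : p ∈ l) : q ∈ l ↔ q - p ∈ S := by
  obtain ⟨m, hm1, hm2⟩ := HasTranslations.exists_translate p S
  have hpm : p ∈ m := by simpa using (hm2 0).1 hS
  have hml : m = l := (hm1.trans hSl).eq_of_mem hpm hp
  subst hml
  rw [hm2, add_sub_cancel]

/-- The subgroup formed by the points of a line through `0`. -/
def lineGroup {S : L} (hS : (0 : P) ∈ S) : AddSubgroup P where
  carrier := {p | p ∈ S}
  zero_mem' := hS
  add_mem' {p q} hp hq := by
    simpa using (mem_iff_sub_mem hS (Parallel.refl S) hp (q := p + q)).2 (by simpa using hq)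
  neg_mem' {p} hp := by
    simpa using (mem_iff_sub_mem hS (Parallel.refl S) hp (q := 0)).1 hS

section Mem

variable {S : L} (hS : (0 : P) ∈ S) {p q : P}

include hS

theorem add_mem_line (hp : p ∈ S) (hq : q ∈ S) : p + q ∈ S := (lineGroup hS).add_mem hp hq

theorem sub_mem_line (hp : p ∈ S) (hq : q ∈ S) : p - q ∈ S := (lineGroup hS).sub_mem hp hq

theorem neg_mem_line (hp : p ∈ S) : -p ∈ S := (lineGroup hS).neg_mem hp

theorem sub_mem_line_comm : p - q ∈ S ↔ q - p ∈ S := (lineGroup hS).sub_mem_comm_iff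

theorem add_mem_line_cancel_left (hp : p ∈ S) : p + q ∈ S ↔ q ∈ S :=
  (lineGroup hS).add_mem_cancel_left hp

end Mem

theorem exists_add_eq {S T : L} (hS : (0 : P) ∈ S) (hT : (0 : P) ∈ T) (hST : S ≠ T) (v : P) :
    ∃ s ∈ S, ∃ t ∈ T, v = s + t := by
  obtain ⟨m, hv, hm⟩ := exists_parallel v T
  obtain ⟨s, hs, hsm⟩ : ∃ s : P, s ∈ S ∧ s ∈ m :=
    exists_common fun h => hST ((h.trans hm).eq_of_mem hS hT)
  exact ⟨s, hs, v - s, (mem_iff_sub_mem hT hm.symm hsm).1 hv, by abel⟩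

theorem eq_of_add_eq {S T : L} (hS : (0 : P) ∈ S) (hT : (0 : P) ∈ T) (hST : S ≠ T) {s s' t t' : P}
    (hs : s ∈ S) (hs' : s' ∈ S) (ht : t ∈ T) (ht' : t' ∈ T) (h : s + t = s' + t') :
    s = s' ∧ t = t' := by
  have h1 : s - s' = t' - t := by rw [sub_eq_sub_iff_add_eq_add, h, add_comm]
  have h2 := eq_zero_of_mem hS hT hST (sub_mem_line hS hs hs') (h1 ▸ sub_mem_line hT ht' ht)
  exact ⟨sub_eq_zero.1 h2, (sub_eq_zero.1 (h1 ▸ h2)).symm⟩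

/-- Parallel lines have the same directions. -/
theorem sub_mem_of_parallel {S l m : L} (hS : (0 : P) ∈ S) (hlm : Parallel (P := P) l m)
    {p q r s : P} (hpq : p ≠ q) (hp : p ∈ l) (hq : q ∈ l) (hr : r ∈ m) (hs : s ∈ m)
    (hpqS : p - q ∈ S) : r - s ∈ S := by
  obtain ⟨T, hT, hTl⟩ := exists_parallel (0 : P) l
  have h1 := (mem_iff_sub_mem hT hTl hq).1 hp
  have hST : S = T := by
    by_contra h
    exact sub_ne_zero.2 hpq (eq_zero_of_mem hS hT h hpqS h1)
  subst hST
  exact (mem_iff_sub_mem hS (hTl.trans hlm) hs).1 hr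

theorem parallelThrough_iff {S : L} (hS : (0 : P) ∈ S) {A B C D : P} (hAB : A ≠ B)
    (hABS : A - B ∈ S) : Frame.ParallelThrough L A B C D ↔ C - D ∈ S := by
  constructor
  · rintro ⟨l, m, hA, hB, hC, hD, hlm⟩
    exact sub_mem_of_parallel hS hlm hAB hA hB hC hD hABS
  · intro h
    obtain ⟨l, hl, hlS⟩ := exists_parallel B S
    obtain ⟨m, hm, hmS⟩ := exists_parallel D S
    exact ⟨l, m, (mem_iff_sub_mem hS hlS.symm hl).2 hABS, hl,
      (mem_iff_sub_mem hS hmS.symm hm).2 h, hm, hlS.trans hmS.symm⟩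

namespace Frame

variable (F : Frame P L)

/-- The line through `0` parallel to the line joining the unit point of the `y`-axis to `a`. -/
noncomputable def direction (a : P) : L :=
  have : Nonempty L := ⟨F.xAxis⟩
  dirLine (a - F.unitY)

omit [HasTranslations P L] in
theorem zero_mem_direction (a : P) : (0 : P) ∈ F.direction a :=
  have : Nonempty L := ⟨F.xAxis⟩
  zero_mem_dirLine _

omit [HasTranslations P L] in
theorem mem_direction (a : P) : a - F.unitY ∈ F.direction a :=
  have : Nonempty L := ⟨F.xAxis⟩
  mem_dirLine _

variable (hO : F.origin = 0)

include hO

omit [IsAffinePlane P L] [HasTranslations P L] in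
theorem zero_mem_x : (0 : P) ∈ F.xAxis := hO ▸ F.origin_mem_x

omit [IsAffinePlane P L] [HasTranslations P L] in
theorem zero_mem_y : (0 : P) ∈ F.yAxis := hO ▸ F.origin_mem_y

omit [IsAffinePlane P L] [HasTranslations P L] in
theorem unitX_ne_zero : F.unitX ≠ 0 := hO ▸ F.unitX_ne

omit [IsAffinePlane P L] [HasTranslations P L] in
theorem unitY_ne_zero : F.unitY ≠ 0 := hO ▸ F.unitY_ne

omit [HasTranslations P L] in
theorem eq_zero_of_mem_axes {p : P} (hx : p ∈ F.xAxis) (hy : p ∈ F.yAxis) : p = 0 :=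
  eq_zero_of_mem (F.zero_mem_x hO) (F.zero_mem_y hO) F.axes_ne hx hy

omit [HasTranslations P L] in
theorem unitY_notMem : F.unitY ∉ F.xAxis := fun h =>
  F.unitY_ne_zero hO (F.eq_zero_of_mem_axes hO h F.unitY_mem)

omit [HasTranslations P L] in
theorem unitX_notMem : F.unitX ∉ F.yAxis := fun h =>
  F.unitX_ne_zero hO (F.eq_zero_of_mem_axes hO F.unitX_mem h)

theorem x_ne_direction {a : P} (ha : a ∈ F.xAxis) : F.xAxis ≠ F.direction a := by
  intro h
  have h1 := F.mem_direction a
  rw [← h] at h1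
  exact F.unitY_notMem hO (by simpa using sub_mem_line (F.zero_mem_x hO) ha h1)

theorem y_ne_direction : F.yAxis ≠ F.direction F.unitX := by
  intro h
  have h1 := F.mem_direction F.unitX
  rw [← h] at h1
  exact F.unitX_notMem hO (by simpa using add_mem_line (F.zero_mem_y hO) h1 F.unitY_mem)

/-- Every direction other than that of the `x`-axis is that of a line joining the unit point of
the `y`-axis to a point of the `x`-axis. -/
theorem exists_eq_direction {T : L} (hT : (0 : P) ∈ T) (hTX : T ≠ F.xAxis) :
    ∃ a ∈ F.xAxis, T = F.direction a := by
  obtain ⟨t, ht, a, ha, h⟩ := exists_add_eq hT (F.zero_mem_x hO) hTX F.unitY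
  refine ⟨a, ha, ?_⟩
  by_contra hne
  have h1 : a - F.unitY = -t := by rw [h]; abel
  have h2 := eq_zero_of_mem hT (F.zero_mem_direction a) hne (h1 ▸ neg_mem_line hT ht)
    (F.mem_direction a)
  exact F.unitY_notMem hO (sub_eq_zero.1 h2 ▸ ha)

theorem exists_toY (b : P) : ∃ q ∈ F.yAxis, b - q ∈ F.direction F.unitX := by
  obtain ⟨q, hq, t, ht, h⟩ := exists_add_eq (F.zero_mem_y hO) (F.zero_mem_direction _)
    (F.y_ne_direction hO) b
  exact ⟨q, hq, by rw [h]; simpa using ht⟩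

omit hO in
/-- The point of the `y`-axis that corresponds to `b`. -/
noncomputable def toY (b : P) : P :=
  Classical.epsilon fun q => q ∈ F.yAxis ∧ b - q ∈ F.direction F.unitX

theorem toY_mem (b : P) : F.toY b ∈ F.yAxis :=
  (Classical.epsilon_spec (F.exists_toY hO b)).1

theorem sub_toY_mem (b : P) : b - F.toY b ∈ F.direction F.unitX :=
  (Classical.epsilon_spec (F.exists_toY hO b)).2

theorem eq_toY {b q : P} (hq : q ∈ F.yAxis) (h : b - q ∈ F.direction F.unitX) :
    q = F.toY b :=
  (eq_of_add_eq (F.zero_mem_y hO) (F.zero_mem_direction _) (F.y_ne_direction hO) hq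
    (F.toY_mem hO b) h (F.sub_toY_mem hO b) (by simp)).1

theorem toY_add (b c : P) : F.toY (b + c) = F.toY b + F.toY c := by
  refine (F.eq_toY hO (add_mem_line (F.zero_mem_y hO) (F.toY_mem hO b) (F.toY_mem hO c)) ?_).symm
  rw [add_sub_add_comm]
  exact add_mem_line (F.zero_mem_direction _) (F.sub_toY_mem hO b) (F.sub_toY_mem hO c)

theorem toY_unitX : F.toY F.unitX = F.unitY :=
  (F.eq_toY hO F.unitY_mem (F.mem_direction _)).symm

theorem eq_zero_of_toY {b : P} (hb : b ∈ F.xAxis) (h : F.toY b = 0) : b = 0 := by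
  have h1 := F.sub_toY_mem hO b
  rw [h, sub_zero] at h1
  exact eq_zero_of_mem (F.zero_mem_x hO) (F.zero_mem_direction _) (F.x_ne_direction hO F.unitX_mem)
    hb h1

theorem toY_injOn {b c : P} (hb : b ∈ F.xAxis) (hc : c ∈ F.xAxis) (h : F.toY b = F.toY c) :
    b = c := by
  have h1 := F.toY_add hO (b - c) c
  rw [sub_add_cancel, h, right_eq_add] at h1
  exact sub_eq_zero.1 (F.eq_zero_of_toY hO (sub_mem_line (F.zero_mem_x hO) hb hc) h1)

theorem exists_toY_eq {q : P} (hq : q ∈ F.yAxis) : ∃ z ∈ F.xAxis, F.toY z = q := by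
  obtain ⟨z, hz, t, ht, h⟩ := exists_add_eq (F.zero_mem_x hO) (F.zero_mem_direction F.unitX)
    (F.x_ne_direction hO F.unitX_mem) q
  refine ⟨z, hz, (F.eq_toY hO hq ?_).symm⟩
  have : z - q = -t := by rw [h]; abel
  exact this ▸ neg_mem_line (F.zero_mem_direction _) ht

theorem exists_mulPt {a : P} (ha : a ∈ F.xAxis) (b : P) :
    ∃ c ∈ F.xAxis, c - F.toY b ∈ F.direction a := by
  obtain ⟨c, hc, t, ht, h⟩ := exists_add_eq (F.zero_mem_x hO) (F.zero_mem_direction a)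
    (F.x_ne_direction hO ha) (F.toY b)
  refine ⟨c, hc, ?_⟩
  have : c - F.toY b = -t := by rw [h]; abel
  exact this ▸ neg_mem_line (F.zero_mem_direction _) ht

omit hO in
/-- The product of points of the `x`-axis. -/
noncomputable def mulPt (a b : P) : P :=
  Classical.epsilon fun c => c ∈ F.xAxis ∧ c - F.toY b ∈ F.direction a

section Mul

variable {a b c : P} (ha : a ∈ F.xAxis)

include ha

theorem mulPt_mem (b : P) : F.mulPt a b ∈ F.xAxis :=
  (Classical.epsilon_spec (F.exists_mulPt hO ha b)).1

theorem mulPt_sub_mem (b : P) : F.mulPt a b - F.toY b ∈ F.direction a :=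
  (Classical.epsilon_spec (F.exists_mulPt hO ha b)).2

theorem eq_mulPt (hc : c ∈ F.xAxis) (h : c - F.toY b ∈ F.direction a) : c = F.mulPt a b := by
  refine sub_eq_zero.1 (eq_zero_of_mem (F.zero_mem_x hO) (F.zero_mem_direction a)
    (F.x_ne_direction hO ha) (sub_mem_line (F.zero_mem_x hO) hc (F.mulPt_mem hO ha b)) ?_)
  simpa using sub_mem_line (F.zero_mem_direction a) h (F.mulPt_sub_mem hO ha b)

theorem mulPt_add (b c : P) : F.mulPt a (b + c) = F.mulPt a b + F.mulPt a c := by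
  refine (F.eq_mulPt hO ha (add_mem_line (F.zero_mem_x hO) (F.mulPt_mem hO ha b)
    (F.mulPt_mem hO ha c)) ?_).symm
  rw [F.toY_add hO, add_sub_add_comm]
  exact add_mem_line (F.zero_mem_direction _) (F.mulPt_sub_mem hO ha b) (F.mulPt_sub_mem hO ha c)

theorem mulPt_zero : F.mulPt a 0 = 0 := by
  simpa using F.mulPt_add hO ha 0 0

theorem mulPt_unit : F.mulPt a F.unitX = a :=
  (F.eq_mulPt hO ha ha (by rw [F.toY_unitX hO]; exact F.mem_direction a)).symm

theorem unit_mulPt : F.mulPt F.unitX a = a :=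
  (F.eq_mulPt hO F.unitX_mem ha (F.sub_toY_mem hO a)).symm

/-- The equation of the line of direction `a` through the point `c` of the `x`-axis. -/
theorem add_toY_sub_mem_iff {x v : P} (hx : x ∈ F.xAxis) (hc : c ∈ F.xAxis) :
    x + F.toY v - c ∈ F.direction a ↔ x + F.mulPt a v = c := by
  have h1 := F.mulPt_sub_mem hO ha v
  rw [← add_mem_line_cancel_left (F.zero_mem_direction a) h1]
  have h2 : F.mulPt a v - F.toY v + (x + F.toY v - c) = x + F.mulPt a v - c := by abel
  rw [h2]
  constructor
  · intro h
    exact sub_eq_zero.1 (eq_zero_of_mem (F.zero_mem_x hO) (F.zero_mem_direction a)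
      (F.x_ne_direction hO ha) (sub_mem_line (F.zero_mem_x hO)
        (add_mem_line (F.zero_mem_x hO) hx (F.mulPt_mem hO ha v)) hc) h)
  · intro h
    rw [h, sub_self]
    exact F.zero_mem_direction a

end Mul

theorem zero_mulPt (b : P) : F.mulPt 0 b = 0 := by
  refine (F.eq_mulPt hO (F.zero_mem_x hO) (F.zero_mem_x hO) ?_).symm
  have h1 : F.direction 0 = F.yAxis := by
    by_contra h
    have h2 := F.mem_direction 0
    rw [zero_sub] at h2
    exact F.unitY_ne_zero hO (neg_eq_zero.1 (eq_zero_of_mem (F.zero_mem_direction 0)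
      (F.zero_mem_y hO) h h2 (neg_mem_line (F.zero_mem_y hO) F.unitY_mem)))
  rw [h1, zero_sub]
  exact neg_mem_line (F.zero_mem_y hO) (F.toY_mem hO b)

end Frame

end Translations

/-! ### Shears and the identities of the multiplication -/

section Shears

theorem IsElation.isCentral {Pt Ln : Type*} [Membership Pt Ln] [IsProjectivePlane Pt Ln] {h k : Ln}
    {f : Equiv.Perm Pt} (hf : IsElation h f) {A W : Pt} (hA : A ∉ h) (hW : W ∈ h) (hWk : W ∈ k)
    (hAk : A ∈ k) (hfA : f A ∈ k) : IsCentral Ln W f := by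
  by_cases hfix : f A = A
  · rw [hf.eq_one hA hfix]
    exact fun p l _ hp => hp
  · obtain ⟨-, Z, hZ, hc⟩ := hf
    obtain ⟨k', h1, h2⟩ := IsProjectivePlane.exists_join (Ln := Ln) Z A
    have h3 := hc A k' h1 h2
    have h4 : Z = W := by grind
    exact h4 ▸ hc

variable {P L : Type*} [Membership P L] [IsAffinePlane P L]

/-- Shears: for a line `X` and two points of a parallel to `X` there is a map of the affine plane
that takes the first point to the second, fixes the points of `X`, moves the other points along
parallels to `X`, and maps parallel lines into parallel lines. -/
theorem exists_shear [Nonempty L] (hE : HasElations (ProjPoint P L) (ProjLine P L)) {X k : L}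
    (hk : Parallel (P := P) k X) {A B : P} (hAX : A ∉ X) (hBX : B ∉ X) (hA : A ∈ k) (hB : B ∈ k) :
    ∃ (φ : P → P) (γ : L → L), φ A = B ∧ (∀ p ∈ X, φ p = p) ∧
      (∀ p l, Parallel (P := P) l X → p ∈ l → φ p ∈ l) ∧ (∀ p l, p ∈ l → φ p ∈ γ l) ∧
      ∀ l m, Parallel (P := P) l m → Parallel (P := P) (γ l) (γ m) := by
  obtain ⟨f, hf, hfA⟩ := hE (.proper X) (.proper A) (.proper B) hAX hBX
  have hX : idealPt X ∈ ProjLine.proper X := idealPt_mem_proper.2 (Parallel.refl X)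
  have hc : IsCentral (ProjLine P L) (idealPt X) f :=
    hf.isCentral (k := .proper k) hAX hX (idealPt_mem_proper.2 hk) hA (by rw [hfA]; exact hB)
  have hinf : ∀ C, C ∉ (ProjLine.atInfinity : ProjLine P L) →
      f C ∉ (ProjLine.atInfinity : ProjLine P L) := by
    intro C hC h
    have := hc.symm hf.1 hX _ _ idealPt_mem_atInfinity h
    rw [Equiv.symm_apply_apply] at this
    exact hC this
  choose φ hφ using fun p : P => exists_proper (hinf (.proper p) proper_notMem_atInfinity)
  choose γ' hγ' using fun l : L => hf.1.exists_line (.proper l)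
  have hγ'' : ∀ l, ∃ m, γ' l = .proper m := by
    intro l
    obtain ⟨p, -, -, hp, -⟩ := IsAffinePlane.two_points (P := P) l
    have h1 := ((hγ' l).2 (.proper p)).1 hp
    rcases h : γ' l with m | _
    · exact ⟨m, rfl⟩
    · rw [h] at h1
      exact (hinf _ proper_notMem_atInfinity h1).elim
  choose γ hγ using hγ''
  refine ⟨φ, γ, ?_, ?_, ?_, ?_, ?_⟩
  · exact ProjPoint.proper.inj ((hφ A).symm.trans hfA)
  · intro p hp
    exact ProjPoint.proper.inj ((hφ p).symm.trans (hf.1.fix hp))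
  · intro p l hl hp
    have := hc (.proper p) (.proper l) (idealPt_mem_proper.2 hl) hp
    rwa [hφ] at this
  · intro p l hp
    have := ((hγ' l).2 (.proper p)).1 hp
    rwa [hφ, hγ] at this
  · intro l m hlm
    have h1 := ((hγ' l).2 (idealPt l)).1 (idealPt_mem_proper.2 (Parallel.refl l))
    have h2 := ((hγ' m).2 (idealPt l)).1 (idealPt_mem_proper.2 hlm.symm)
    obtain ⟨n, hn⟩ := exists_idealPt (hc (idealPt l) _ idealPt_mem_atInfinity
      idealPt_mem_atInfinity)
    rw [hn, hγ] at h1 h2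
    exact (idealPt_mem_proper.1 h1).trans (idealPt_mem_proper.1 h2).symm

namespace Frame

variable [AddCommGroup P] [HasTranslations P L] (F : Frame P L) (hO : F.origin = 0)
  (hE : HasElations (ProjPoint P L) (ProjLine P L))

include hO hE

/-- The right distributive law, by means of the shear along the `x`-axis that moves the unit
point of the `y`-axis by `s`. -/
theorem sub_mulPt {a s : P} (ha : a ∈ F.xAxis) (hs : s ∈ F.xAxis) (b : P) :
    F.mulPt (a - s) b = F.mulPt a b - F.mulPt s b := by
  have : Nonempty L := ⟨F.xAxis⟩
  have h0 := F.zero_mem_x hO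
  have he := F.unitY_notMem hO
  obtain ⟨k, hk, hkX⟩ := exists_parallel F.unitY F.xAxis
  have hek : F.unitY + s ∈ k := (mem_iff_sub_mem h0 hkX.symm hk).2 (by simpa using hs)
  have hes : F.unitY + s ∉ F.xAxis := fun h => he (by simpa using sub_mem_line h0 h hs)
  obtain ⟨φ, γ, hφe, hφX, hφ, hφγ, hγ⟩ := exists_shear hE hkX he hes hk hek
  have hf : φ (F.toY b) - F.toY b ∈ F.xAxis := by
    obtain ⟨m, hm, hmX⟩ := exists_parallel (F.toY b) F.xAxis
    exact (mem_iff_sub_mem h0 hmX.symm hm).1 (hφ _ m hmX hm)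
  have key : ∀ a ∈ F.xAxis,
      F.mulPt (a - s) b = F.mulPt a b - (φ (F.toY b) - F.toY b) := by
    intro a ha
    refine (F.eq_mulPt hO (sub_mem_line h0 ha hs)
      (sub_mem_line h0 (F.mulPt_mem hO ha b) hf) ?_).symm
    have hd := F.zero_mem_direction a
    obtain ⟨n, hn, hnS⟩ := exists_parallel (F.toY b) (F.direction a)
    obtain ⟨n', hn', hnS'⟩ := exists_parallel F.unitY (F.direction a)
    have h1 := (mem_iff_sub_mem hd hnS.symm hn).2 (F.mulPt_sub_mem hO ha b)
    have h2 := (mem_iff_sub_mem hd hnS'.symm hn').2 (F.mem_direction a)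
    have h3 := hφγ _ _ h1
    have h4 := hφγ _ _ h2
    have h5 := hφγ _ _ hn'
    rw [hφX _ (F.mulPt_mem hO ha b)] at h3
    rw [hφX _ ha] at h4
    rw [hφe] at h5
    have h6 := sub_mem_of_parallel (F.zero_mem_direction (a - s))
      (hγ _ _ (hnS'.trans hnS.symm)) (by rintro rfl; exact hes ha) h4 h5 h3 (hφγ _ _ hn)
      (by have := F.mem_direction (a - s); rwa [sub_sub, add_comm s] at this)
    have h7 : F.mulPt a b - (φ (F.toY b) - F.toY b) - F.toY b = F.mulPt a b - φ (F.toY b) := by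
      abel
    rwa [h7]
  have h1 := key s hs
  rw [sub_self, F.zero_mulPt hO] at h1
  rw [key a ha, ← sub_eq_zero.1 h1.symm]

/-- The shear along the `y`-axis that moves the `x`-axis to the line joining the origin to
`unitX - unitY` acts on directions of lines; this yields the left inverse law. -/
theorem exists_mulPt_mulPt_add {a : P} (ha : a ∈ F.xAxis) (ha1 : a + F.unitX ≠ 0) :
    ∃ a' ∈ F.xAxis, ∀ b ∈ F.xAxis, F.mulPt a' (F.mulPt a b + b) = F.mulPt a b := by
  have : Nonempty L := ⟨F.xAxis⟩
  have h0 := F.zero_mem_x hO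
  have h0y := F.zero_mem_y hO
  have hi := F.unitX_notMem hO
  obtain ⟨k, hk, hkY⟩ := exists_parallel F.unitX F.yAxis
  have hik : F.unitX - F.unitY ∈ k := (mem_iff_sub_mem h0y hkY.symm hk).2
    (by simpa using neg_mem_line h0y F.unitY_mem)
  have hiy : F.unitX - F.unitY ∉ F.yAxis := fun h =>
    hi (by simpa using add_mem_line h0y h F.unitY_mem)
  obtain ⟨φ, γ, hφi, hφY, hφ, hφγ, hγ⟩ := exists_shear hE hkY hi hiy hk hik
  have hφ0 : φ 0 = 0 := hφY 0 h0y
  -- the image of the `x`-axis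
  have hγX : γ F.xAxis = F.direction F.unitX := by
    have h1 := hφγ _ _ h0
    have h2 := hφγ _ _ F.unitX_mem
    rw [hφ0] at h1
    rw [hφi] at h2
    refine IsAffinePlane.line_unique _ 0 _ _ ?_ h2 h1 (F.mem_direction _)
      (F.zero_mem_direction _)
    intro h
    exact hiy (h ▸ h0y)
  have hφx : ∀ x ∈ F.xAxis, φ x = x - F.toY x := by
    intro x hx
    have h1 := hφγ _ _ hx
    rw [hγX] at h1
    have h2 : φ x - x ∈ F.yAxis := by
      obtain ⟨m, hm, hmY⟩ := exists_parallel x F.yAxis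
      exact (mem_iff_sub_mem h0y hmY.symm hm).1 (hφ _ m hmY hm)
    rw [← F.eq_toY hO (b := x) (q := x - φ x) ((sub_mem_line_comm h0y).1 h2) (by simpa using h1)]
    abel
  have hT0 : (0 : P) ∈ γ (F.direction a) := by
    have := hφγ _ _ (F.zero_mem_direction a)
    rwa [hφ0] at this
  have key : ∀ b, F.mulPt a b - F.toY (F.mulPt a b + b) ∈ γ (F.direction a) := by
    intro b
    obtain ⟨n, hn, hnS⟩ := exists_parallel (F.toY b) (F.direction a)
    have h1 := (mem_iff_sub_mem (F.zero_mem_direction a) hnS.symm hn).2 (F.mulPt_sub_mem hO ha b)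
    have h2 := (mem_iff_sub_mem hT0 (hγ _ _ hnS.symm) (hφγ _ _ hn)).1 (hφγ _ _ h1)
    rwa [hφx _ (F.mulPt_mem hO ha b), hφY _ (F.toY_mem hO b), sub_sub, ← F.toY_add hO] at h2
  have hTX : γ (F.direction a) ≠ F.xAxis := by
    intro h
    have h1 := key F.unitX
    rw [h, F.mulPt_unit hO ha] at h1
    have h2 : F.toY (a + F.unitX) ∈ F.xAxis := by simpa using sub_mem_line h0 ha h1
    exact ha1 (F.eq_zero_of_toY hO (add_mem_line h0 ha F.unitX_mem)
      (F.eq_zero_of_mem_axes hO h2 (F.toY_mem hO _)))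
  obtain ⟨a', ha', hT⟩ := F.exists_eq_direction hO hT0 hTX
  exact ⟨a', ha', fun b _ => (F.eq_mulPt hO ha' (F.mulPt_mem hO ha b) (hT ▸ key b)).symm⟩

/-- The elation whose axis is the `x`-axis and whose centre is the origin, and which moves the
unit point of the `y`-axis to infinity, yields the right inverse law. -/
theorem exists_mulPt_sub_mulPt {b : P} (hb : b ∈ F.xAxis) (hb1 : b ≠ F.unitX) :
    ∃ z ∈ F.xAxis, ∀ m ∈ F.xAxis, F.mulPt (m - F.mulPt m b) z = F.mulPt m b := by
  have : Nonempty L := ⟨F.xAxis⟩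
  have h0 := F.zero_mem_x hO
  have h0y := F.zero_mem_y hO
  have hYX : ¬ Parallel (P := P) F.xAxis F.yAxis := fun h => F.axes_ne (h.eq_of_mem h0 h0y)
  have hYy : idealPt F.yAxis ∈ ProjLine.proper F.yAxis := idealPt_mem_proper.2 (Parallel.refl _)
  obtain ⟨f, hf, hfe⟩ := hE (.proper F.xAxis) (.proper F.unitY) (idealPt F.yAxis)
    (F.unitY_notMem hO) (fun h => hYX (idealPt_mem_proper.1 h))
  have hc : IsCentral (ProjLine P L) (.proper (0 : P)) f :=
    hf.isCentral (k := .proper F.yAxis) (F.unitY_notMem hO) h0 h0y F.unitY_mem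
      (by rw [hfe]; exact hYy)
  -- the image of the point of the `y`-axis that corresponds to `b`
  have h1 := hc (.proper (F.toY b)) (.proper F.yAxis) h0y (F.toY_mem hO b)
  have h2 : f (.proper (F.toY b)) ∉ (ProjLine.atInfinity : ProjLine P L) := by
    intro h
    obtain ⟨l, hl⟩ := exists_idealPt h
    rw [hl] at h1
    rw [← idealPt_eq.2 (idealPt_mem_proper.1 h1), ← hfe] at hl
    have h3 := ProjPoint.proper.inj (f.injective hl)
    rw [← F.toY_unitX hO] at h3
    exact hb1 (F.toY_injOn hO hb F.unitX_mem h3)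
  obtain ⟨q, hq⟩ := exists_proper h2
  rw [hq] at h1
  obtain ⟨z, hz, hzq⟩ := F.exists_toY_eq hO (q := q) h1
  refine ⟨z, hz, fun m hm => ?_⟩
  have hcX := F.mulPt_mem hO hm b
  set c := F.mulPt m b with hcdef
  have hmc := sub_mem_line h0 hm hcX
  refine (F.eq_mulPt hO hmc hcX ?_).symm
  -- the line through `toY b` and `c` passes through `c - m + unitY`
  obtain ⟨n, hn, hnS⟩ := exists_parallel (F.toY b) (F.direction m)
  have hd := F.zero_mem_direction m
  have hcn : c ∈ n := (mem_iff_sub_mem hd hnS.symm hn).2 (F.mulPt_sub_mem hO hm b)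
  have hwn : c - m + F.unitY ∈ n := by
    refine (mem_iff_sub_mem hd hnS.symm hcn).2 ((sub_mem_line_comm hd).1 ?_)
    have : c - (c - m + F.unitY) = m - F.unitY := by abel
    exact this ▸ F.mem_direction m
  -- which is on the line through `unitY` that is mapped to the line at infinity
  obtain ⟨l, hl, hlX⟩ := exists_parallel F.unitY F.xAxis
  have hwl : c - m + F.unitY ∈ l :=
    (mem_iff_sub_mem h0 hlX.symm hl).2 (by simpa using sub_mem_line h0 hcX hm)
  have hw : f (.proper (c - m + F.unitY)) ∈ (ProjLine.atInfinity : ProjLine P L) := by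
    obtain ⟨l', -, hl'⟩ := hf.1.exists_line (.proper l)
    have h3 := (hl' _).1 (proper_mem_proper.2 hl)
    have h4 := (hl' (idealPt F.xAxis)).1 (idealPt_mem_proper.2 hlX)
    rw [hfe] at h3
    rw [hf.1.fix (idealPt_mem_proper.2 (Parallel.refl F.xAxis))] at h4
    have h5 : l' = .atInfinity := (IsProjectivePlane.eq_or_eq h3 h4 idealPt_mem_atInfinity
      idealPt_mem_atInfinity).resolve_left fun h => hYX (idealPt_eq.1 h.symm)
    exact h5 ▸ (hl' _).1 (proper_mem_proper.2 hwl)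
  obtain ⟨s, hs⟩ := exists_idealPt hw
  have hd' := F.zero_mem_direction (m - c)
  have hwS : c - m + F.unitY ∈ F.direction (m - c) := by
    have := neg_mem_line hd' (F.mem_direction (m - c))
    have h3 : -(m - c - F.unitY) = c - m + F.unitY := by abel
    rwa [h3] at this
  have h3 := hc _ (.proper (F.direction (m - c))) hd' (proper_mem_proper.2 hwS)
  rw [hs] at h3
  obtain ⟨n', -, hn'⟩ := hf.1.exists_line (.proper n)
  have h4 := (hn' _).1 (proper_mem_proper.2 hn)
  have h5 := (hn' _).1 (proper_mem_proper.2 hcn)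
  have h6 := (hn' _).1 (proper_mem_proper.2 hwn)
  rw [hq] at h4
  rw [hf.1.fix (proper_mem_proper.2 hcX)] at h5
  rw [hs] at h6
  rcases n' with n' | _
  · have h7 := (idealPt_mem_proper.1 h3).trans (idealPt_mem_proper.1 h6).symm
    rw [hzq]
    exact (mem_iff_sub_mem hd' h7 h4).1 h5
  · exact (proper_notMem_atInfinity h4).elim

end Frame

end Shears

/-! ### Alternative fields from inverse laws -/

section Alternative

/-- A ring whose left multiplications have left multiplications as left inverses is left
alternative: the operators of left multiplication satisfy
`L_a⁻¹ - L_(1+a)⁻¹ = (L_a + L_a²)⁻¹`. -/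
theorem left_alternative_of_inverse {K : Type*} [NonAssocRing K]
    (hl : ∀ c : K, c ≠ 0 → ∃ d, ∀ b, d * (c * b) = b) (a b : K) : a * (a * b) = a * a * b := by
  by_cases ha : a = 0
  · simp [ha]
  by_cases ha1 : 1 + a = 0
  · have : a = -1 := by rw [eq_neg_iff_add_eq_zero, add_comm, ha1]
    simp [this]
  obtain ⟨d, hd⟩ := hl a ha
  obtain ⟨e, he⟩ := hl (1 + a) ha1
  have hu : ∀ b, (d - e) * (a * b + a * (a * b)) = b := by
    intro b
    have h1 : a * b + a * (a * b) = (1 + a) * (a * b) := by rw [add_mul, one_mul]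
    rw [sub_mul]
    nth_rewrite 2 [h1]
    rw [he, mul_add, hd, hd, add_sub_cancel_right]
  by_cases hK : ∀ x : K, x = 0
  · rw [hK (a * (a * b)), hK (a * a * b)]
  have hu0 : d - e ≠ 0 := by
    intro h
    refine hK fun x => ?_
    rw [← hu x, h, zero_mul]
  obtain ⟨v, hv⟩ := hl _ hu0
  have hvb : ∀ b, v * b = a * b + a * (a * b) := by
    intro b
    have := hv (a * b + a * (a * b))
    rwa [hu] at this
  have hv1 : v = a + a * a := by simpa using hvb 1
  have := hvb b
  rw [hv1, add_mul] at this
  exact (add_left_cancel this).symm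

/-- The left alternative law in the opposite ring. -/
theorem right_alternative_of_inverse {K : Type*} [NonAssocRing K]
    (hr : ∀ c : K, c ≠ 0 → ∃ d, ∀ b, b * c * d = b) (a b : K) : b * a * a = b * (a * a) := by
  have := left_alternative_of_inverse (K := Kᵐᵒᵖ) (fun c hc => by
    obtain ⟨d, hd⟩ := hr c.unop (by simpa using hc)
    exact ⟨.op d, fun b => MulOpposite.unop_injective (hd b.unop)⟩) (.op a) (.op b)
  exact MulOpposite.op_injective this

/-- The flexible law is the left alternative law linearized. -/
theorem flexible_of_alternative {K : Type*} [NonAssocRing K]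
    (h₁ : ∀ a b : K, a * (a * b) = a * a * b) (h₂ : ∀ a b : K, b * a * a = b * (a * a))
    (a b : K) : a * (b * a) = a * b * a := by
  have h3 := h₁ (a + b) a
  have h4 := h₂ a b
  have h5 := h₁ a a
  have h6 := h₁ b a
  simp only [add_mul, mul_add] at h3
  rw [h4, h5, h6] at h3
  rw [← sub_eq_zero] at h3 ⊢
  rw [← h3]
  abel

/-- A nontrivial ring in which multiplication by a nonzero element, on either side, is inverted by
the multiplication with some element is an alternative field. -/
@[reducible]
noncomputable def AlternativeField.ofInverse {K : Type*} [NonAssocRing K] [Nontrivial K]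
    (hl : ∀ c : K, c ≠ 0 → ∃ d, ∀ b, d * (c * b) = b)
    (hr : ∀ c : K, c ≠ 0 → ∃ d, ∀ b, b * c * d = b) : AlternativeField K :=
  have key : ∀ c : K, ∃ d, c ≠ 0 → c * d = 1 ∧ d * c = 1 ∧ (∀ b, c * (d * b) = b) ∧
      (∀ b, d * (c * b) = b) ∧ (∀ b, b * c * d = b) ∧ ∀ b, b * d * c = b := by
    intro c
    by_cases hc : c = 0
    · exact ⟨0, fun h => (h hc).elim⟩
    obtain ⟨d, hd⟩ := hl c hc
    have hdc : d * c = 1 := by simpa using hd 1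
    have hd0 : d ≠ 0 := by rintro rfl; simp at hdc
    obtain ⟨c', hc'⟩ := hl d hd0
    have hcb : ∀ b, c * b = c' * b := fun b => by
      have := hc' (c * b)
      rw [hd] at this
      exact this.symm
    obtain ⟨d', hd'⟩ := hr c hc
    have hdd : d' = d := by
      have h1 : c * d' = 1 := by simpa using hd' 1
      have h2 := hd d'
      rwa [h1, mul_one, eq_comm] at h2
    subst hdd
    obtain ⟨c'', hc''⟩ := hr d' hd0
    have hbc : ∀ b, b * c = b * c'' := fun b => by
      have := hc'' (b * c)
      rw [hd'] at this
      exact this.symm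
    exact ⟨d', fun _ => ⟨by simpa using hd' 1, hdc, fun b => by rw [hcb, hc'], hd, hd',
      fun b => by rw [hbc, hc'']⟩⟩
  @AlternativeField.mk K inferInstance ⟨fun c => (key c).choose⟩ inferInstance
    (left_alternative_of_inverse hl) (right_alternative_of_inverse hr)
    (flexible_of_alternative (left_alternative_of_inverse hl) (right_alternative_of_inverse hr))
    (fun a ha => ((key a).choose_spec ha).1)
    (fun a ha => ((key a).choose_spec ha).2.1)
    (fun a b ha => ((key a).choose_spec ha).2.2.1 b)
    (fun a b ha => ((key a).choose_spec ha).2.2.2.1 b)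
    (fun a b ha => ((key a).choose_spec ha).2.2.2.2.1 b)
    (fun a b ha => ((key a).choose_spec ha).2.2.2.2.2 b)

/-- The equations `y + a x = c` and `x + b y = d` describe the same lines for `a ≠ 0`, `b = a⁻¹`. -/
theorem AlternativeField.add_mul_eq_iff {K : Type*} [AlternativeField K] {a : K} (ha : a ≠ 0)
    (x y c : K) : y + a * x = c ↔ x + a⁻¹ * y = a⁻¹ * c := by
  constructor
  · rintro rfl
    rw [mul_add, AlternativeField.inv_mul_mul a x ha, add_comm]
  · intro h
    have := congrArg (a * ·) h
    simp only [mul_add, AlternativeField.mul_inv_mul a _ ha] at this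
    rw [← this, add_comm]

end Alternative

/-! ### The field of segments -/

section Segments

variable {P L : Type*} [Membership P L] [IsAffinePlane P L] [AddCommGroup P] [HasTranslations P L]

namespace Frame

variable (F : Frame P L)

/-- The segments form an alternative field, with the addition of points of the `x`-axis. -/
theorem exists_alternativeField (hO : F.origin = 0)
    (hE : HasElations (ProjPoint P L) (ProjLine P L)) :
    ∃ _ : AlternativeField F.Segment, (0 : F.Segment) = F.zeroSegment ∧
      (1 : F.Segment) = F.unitSegment ∧ (∀ a b : F.Segment, (a + b).1 = a.1 + b.1) ∧
      ∀ a b : F.Segment, (a * b).1 = F.mulPt a.1 b.1 := by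
  let grp : AddCommGroup F.Segment :=
    inferInstanceAs (AddCommGroup (lineGroup (F.zero_mem_x hO)))
  let : Mul F.Segment := ⟨fun a b => ⟨F.mulPt a.1 b.1, F.mulPt_mem hO a.2 b.1⟩⟩
  let : One F.Segment := ⟨F.unitSegment⟩
  have hadd : ∀ a b : F.Segment, (a + b).1 = a.1 + b.1 := fun _ _ => rfl
  have hneg : ∀ a : F.Segment, (-a).1 = -a.1 := fun _ => rfl
  have hmul : ∀ a b : F.Segment, (a * b).1 = F.mulPt a.1 b.1 := fun _ _ => rfl
  have hzero : (0 : F.Segment).1 = 0 := rfl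
  have hone : (1 : F.Segment).1 = F.unitX := rfl
  have ext : ∀ {a b : F.Segment}, a.1 = b.1 → a = b := fun h => Subtype.ext h
  let ring : NonAssocRing F.Segment :=
    { grp with
      left_distrib := fun a b c => ext (F.mulPt_add hO a.2 b.1 c.1)
      right_distrib := fun a b c => ext (by
        have h := F.sub_mulPt hO hE a.2 (-b).2 c.1
        have h' := F.sub_mulPt hO hE (F.zero_mem_x hO) b.2 c.1
        rw [zero_sub, F.zero_mulPt hO, zero_sub] at h'
        rwa [hneg, h', sub_neg_eq_add, sub_neg_eq_add] at h)
      zero_mul := fun a => ext (F.zero_mulPt hO a.1)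
      mul_zero := fun a => ext (F.mulPt_zero hO a.2)
      one_mul := fun a => ext (F.unit_mulPt hO a.2)
      mul_one := fun a => ext (F.mulPt_unit hO a.2) }
  have : Nontrivial F.Segment := ⟨0, 1, fun h => F.unitX_ne_zero hO (congrArg Subtype.val h).symm⟩
  have hl : ∀ c : F.Segment, c ≠ 0 → ∃ d, ∀ b, d * (c * b) = b := by
    intro c hc
    obtain ⟨a', ha', h⟩ := F.exists_mulPt_mulPt_add hO hE (c - 1).2
      (fun h => hc (ext (by rw [hzero, ← h, ← hone, ← hadd, sub_add_cancel])))
    obtain ⟨d, rfl⟩ : ∃ d : F.Segment, d.1 = a' := ⟨⟨a', ha'⟩, rfl⟩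
    refine ⟨1 - d, fun b => ?_⟩
    have h1 : d * ((c - 1) * b + b) = (c - 1) * b := ext (h b.1 b.2)
    rw [sub_mul, one_mul, sub_add_cancel] at h1
    rw [sub_mul, one_mul, h1, sub_sub_cancel]
  have hr : ∀ c : F.Segment, c ≠ 0 → ∃ d, ∀ b, b * c * d = b := by
    intro c hc
    obtain ⟨z, hz, h⟩ := F.exists_mulPt_sub_mulPt hO hE (1 - c).2
      (fun h => hc (sub_eq_self.1 (ext h)))
    obtain ⟨d, rfl⟩ : ∃ d : F.Segment, d.1 = z := ⟨⟨z, hz⟩, rfl⟩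
    refine ⟨d + 1, fun m => ?_⟩
    have h1 : (m - m * (1 - c)) * d = m * (1 - c) := ext (h m.1 m.2)
    rw [mul_sub, mul_one, sub_sub_cancel] at h1
    rw [mul_add, mul_one, h1, sub_add_cancel]
  exact ⟨AlternativeField.ofInverse hl hr, ext hO.symm, rfl, hadd, hmul⟩

variable {F}

theorem corresponds_iff (hO : F.origin = 0) {b : F.Segment} {q : P} :
    F.Corresponds b q ↔ q = F.toY b.1 := by
  have hne : F.unitX ≠ F.unitY := fun h => F.unitX_notMem hO (h ▸ F.unitY_mem)
  rw [Corresponds, parallelThrough_iff (F.zero_mem_direction F.unitX) hne (F.mem_direction _)]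
  constructor
  · exact fun h => F.eq_toY hO h.1 h.2
  · rintro rfl
    exact ⟨F.toY_mem hO _, F.sub_toY_mem hO _⟩

theorem isProduct_iff (hO : F.origin = 0) {a b c : F.Segment} :
    F.IsProduct a b c ↔ c.1 = F.mulPt a.1 b.1 := by
  have hne : F.unitY ≠ a.1 := fun h => F.unitY_notMem hO (h ▸ a.2)
  have hd := F.zero_mem_direction a.1
  have hS := (sub_mem_line_comm hd).1 (F.mem_direction a.1)
  simp only [IsProduct, corresponds_iff hO, parallelThrough_iff hd hne hS, exists_eq_left]
  rw [sub_mem_line_comm hd]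
  constructor
  · exact fun h => F.eq_mulPt hO a.2 c.2 h
  · intro h
    rw [h]
    exact F.mulPt_sub_mem hO a.2 b.1

theorem isSum_iff (hO : F.origin = 0) {g : L} (hg : Parallel (P := P) g F.xAxis)
    (hgX : g ≠ F.xAxis) {a b c : F.Segment} : F.IsSum g a b c ↔ c.1 = a.1 + b.1 := by
  have h0 := F.zero_mem_x hO
  have h0y := F.zero_mem_y hO
  have hpX : ∀ p ∈ g, p ∉ F.xAxis := fun p hp hpx => hgX (hg.eq_of_mem hp hpx)
  constructor
  · rintro ⟨p, q, hpg, hpy, hqg, ⟨n, hn, hbn, hqn⟩, l, m, hpl, hal, hqm, hcm, hlm⟩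
    have h1 : q - p ∈ F.xAxis := (mem_iff_sub_mem h0 hg.symm hpg).1 hqg
    have h2 : q - b.1 ∈ F.yAxis := (mem_iff_sub_mem h0y hn.symm hbn).1 hqn
    have hq : q - p = b.1 :=
      (eq_of_add_eq h0 h0y F.axes_ne h1 b.2 hpy h2 (by simp)).1
    have hpa : p ≠ a.1 := fun h => hpX p hpg (h ▸ a.2)
    have : Nonempty L := ⟨F.xAxis⟩
    have hS := zero_mem_dirLine (L := L) (p - a.1)
    have hXS : F.xAxis ≠ (dirLine (p - a.1) : L) := by
      intro h
      have h3 := mem_dirLine (L := L) (p - a.1)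
      rw [← h] at h3
      exact hpX p hpg (by simpa using add_mem_line h0 h3 a.2)
    have h3 := sub_mem_of_parallel hS hlm hpa hpl hal hqm hcm (mem_dirLine (L := L) (p - a.1))
    exact (eq_of_add_eq h0 hS hXS c.2 (add_mem_line h0 a.2 b.2) h3 (mem_dirLine (L := L) (p - a.1))
      (by rw [← hq]; abel)).1
  · intro hc
    obtain ⟨p, hpg, hpy⟩ : ∃ p : P, p ∈ g ∧ p ∈ F.yAxis :=
      exists_common fun h => F.axes_ne ((hg.symm.trans h).eq_of_mem h0 h0y)
    obtain ⟨n, hn, hnY⟩ := exists_parallel b.1 F.yAxis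
    have : Nonempty L := ⟨F.xAxis⟩
    have hpa : p ≠ a.1 := fun h => hpX p hpg (h ▸ a.2)
    refine ⟨p, p + b.1, hpg, hpy, (mem_iff_sub_mem h0 hg.symm hpg).2 (by simp [b.2]),
      ⟨n, hnY, hn, (mem_iff_sub_mem h0y hnY.symm hn).2 (by simpa using hpy)⟩, ?_⟩
    rw [parallelThrough_iff (zero_mem_dirLine (L := L) (p - a.1)) hpa (mem_dirLine _), hc,
      add_sub_add_right_eq_sub]
    exact mem_dirLine _

theorem hasCoordinates_iff (hO : F.origin = 0) {p : P} {x y : F.Segment} :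
    F.HasCoordinates p x y ↔ p = x.1 + F.toY y.1 := by
  have h0 := F.zero_mem_x hO
  have h0y := F.zero_mem_y hO
  simp only [HasCoordinates, corresponds_iff hO]
  constructor
  · rintro ⟨⟨n, hn, hpn, hxn⟩, h, hh, hph, q, hqh, rfl⟩
    have h1 := (mem_iff_sub_mem h0y hn.symm hxn).1 hpn
    have h2 := (mem_iff_sub_mem h0 hh.symm hqh).1 hph
    have h3 := (eq_of_add_eq h0 h0y F.axes_ne h2 x.2 (F.toY_mem hO y.1) h1 (by simp)).1
    rw [← h3, sub_add_cancel]
  · rintro rfl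
    obtain ⟨n, hn, hnY⟩ := exists_parallel x.1 F.yAxis
    obtain ⟨h, hh, hhX⟩ := exists_parallel (F.toY y.1) F.xAxis
    exact ⟨⟨n, hnY, (mem_iff_sub_mem h0y hnY.symm hn).2 (by simpa using F.toY_mem hO y.1), hn⟩,
      h, hhX, (mem_iff_sub_mem h0 hhX.symm hh).2 (by simp [x.2]), _, hh, rfl⟩

/-- The coordinates of the points. -/
noncomputable def coordinates (hO : F.origin = 0) : P ≃ F.Segment × F.Segment :=
  (Equiv.ofBijective (fun s : F.Segment × F.Segment => s.1.1 + F.toY s.2.1) <| by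
    have h0 := F.zero_mem_x hO
    have h0y := F.zero_mem_y hO
    constructor
    · rintro ⟨x, y⟩ ⟨x', y'⟩ h
      have h1 := eq_of_add_eq h0 h0y F.axes_ne x.2 x'.2 (F.toY_mem hO y.1) (F.toY_mem hO y'.1) h
      exact Prod.ext (Subtype.ext h1.1) (Subtype.ext (F.toY_injOn hO y.2 y'.2 h1.2))
    · intro p
      obtain ⟨x, hx, q, hq, h⟩ := exists_add_eq h0 h0y F.axes_ne p
      obtain ⟨y, hy, rfl⟩ := F.exists_toY_eq hO hq
      exact ⟨(⟨x, hx⟩, ⟨y, hy⟩), h.symm⟩).symm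

theorem coordinates_eq_iff (hO : F.origin = 0) {p : P} {x y : F.Segment} :
    coordinates hO p = (x, y) ↔ p = x.1 + F.toY y.1 :=
  Equiv.symm_apply_eq _

theorem eq_coordinates (hO : F.origin = 0) (p : P) :
    p = (coordinates hO p).1.1 + F.toY (coordinates hO p).2.1 :=
  (coordinates_eq_iff hO).1 rfl

theorem mem_iff_of_parallel_x (hO : F.origin = 0) {l : L} (hl : Parallel (P := P) l F.xAxis)
    {c : F.Segment} (hc : F.toY c.1 ∈ l) (p : P) : p ∈ l ↔ (coordinates hO p).2 = c := by
  have h0 := F.zero_mem_x hO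
  rw [mem_iff_sub_mem h0 hl.symm hc]
  nth_rewrite 1 [eq_coordinates hO p]
  rw [add_sub_assoc, add_mem_line_cancel_left h0 (coordinates hO p).1.2]
  constructor
  · intro h
    exact Subtype.ext (F.toY_injOn hO (coordinates hO p).2.2 c.2 (sub_eq_zero.1
      (F.eq_zero_of_mem_axes hO h (sub_mem_line (F.zero_mem_y hO) (F.toY_mem hO _)
        (F.toY_mem hO _)))))
  · intro h
    rw [h, sub_self]
    exact h0

/-- The lines not parallel to the `x`-axis have the equations `x + b y = c`, where `c` is the
intersection with the `x`-axis and `b` gives the direction. -/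
theorem mem_iff_of_parallel_direction (hO : F.origin = 0) {l : L} {b c : F.Segment}
    (hl : Parallel (P := P) l (F.direction b.1)) (hc : c.1 ∈ l) (p : P) :
    p ∈ l ↔ (coordinates hO p).1.1 + F.mulPt b.1 (coordinates hO p).2.1 = c.1 := by
  rw [mem_iff_sub_mem (F.zero_mem_direction b.1) hl.symm hc]
  nth_rewrite 1 [eq_coordinates hO p]
  exact F.add_toY_sub_mem_iff hO b.2 (coordinates hO p).1.2 c.2

end Frame

end Segments

theorem mainTheorem2 {P L : Type*} [Membership P L] [IsAffinePlane P L]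
    (hD₂ : DesarguesTwo P L)
    (hDiag : DiagonalPointsNotCollinear P L ∨ LittleDesargues P L)
    (F : Frame P L) :
    ∃ _ : AlternativeField F.Segment,
      -- zero and unit element
      (0 : F.Segment) = F.zeroSegment ∧ (1 : F.Segment) = F.unitSegment ∧
      -- the sum, for every choice of the auxiliary line, and the product
      (∀ g : L, Parallel g F.xAxis → g ≠ F.xAxis →
        ∀ a b c : F.Segment, F.IsSum g a b c ↔ c = a + b) ∧
      (∀ a b c : F.Segment, F.IsProduct a b c ↔ c = a * b) ∧
      -- points are number pairs
      ∃ xy : P ≃ F.Segment × F.Segment,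
        (∀ (p : P) (x y : F.Segment), F.HasCoordinates p x y ↔ xy p = (x, y)) ∧
        -- lines are given by the equations `x = c` and `y + a * x = c`
        (∀ l : L, (∃ c, ∀ p : P, p ∈ l ↔ (xy p).1 = c) ∨
          (∃ a c, ∀ p : P, p ∈ l ↔ (xy p).2 + a * (xy p).1 = c)) ∧
        (∀ c, ∃ l : L, ∀ p : P, p ∈ l ↔ (xy p).1 = c) ∧
        (∀ a c, ∃ l : L, ∀ p : P, p ∈ l ↔ (xy p).2 + a * (xy p).1 = c) ∧
        -- equally by the equations `y = c` and `x + b * y = c`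
        (∀ l : L, (∃ c, ∀ p : P, p ∈ l ↔ (xy p).2 = c) ∨
          (∃ b c, ∀ p : P, p ∈ l ↔ (xy p).1 + b * (xy p).2 = c)) ∧
        (∀ c, ∃ l : L, ∀ p : P, p ∈ l ↔ (xy p).2 = c) ∧
        (∀ b c, ∃ l : L, ∀ p : P, p ∈ l ↔ (xy p).1 + b * (xy p).2 = c) := by
  have : Nonempty L := ⟨F.xAxis⟩
  have hE : HasElations (ProjPoint P L) (ProjLine P L) := by
    rcases hDiag with h | h
    · exact hD₂.fourthHarmonicLine.hasElations h.fanoLine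
    · exact h.littleDesarguesLine.hasElations
  obtain ⟨grp, h0, htr⟩ := exists_addCommGroup hE F.origin
  have : HasTranslations P L := ⟨htr⟩
  have hO := h0.symm
  obtain ⟨K, hzero, hone, hadd, hmul⟩ := F.exists_alternativeField hO hE
  have ext : ∀ {a b : F.Segment}, a = b ↔ a.1 = b.1 := Subtype.ext_iff
  -- lines in the second form
  have hline : ∀ l : L, (∃ c, ∀ p : P, p ∈ l ↔ (Frame.coordinates hO p).2 = c) ∨
      (∃ b c, ∀ p : P, p ∈ l ↔
        (Frame.coordinates hO p).1 + b * (Frame.coordinates hO p).2 = c) := by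
    intro l
    by_cases hl : Parallel (P := P) l F.xAxis
    · obtain ⟨q, hql, hqy⟩ : ∃ p : P, p ∈ l ∧ p ∈ F.yAxis := exists_common fun h =>
        F.axes_ne ((hl.symm.trans h).eq_of_mem F.origin_mem_x F.origin_mem_y)
      obtain ⟨c, hc, rfl⟩ := F.exists_toY_eq hO hqy
      exact Or.inl ⟨⟨c, hc⟩, Frame.mem_iff_of_parallel_x hO (c := ⟨c, hc⟩) hl hql⟩
    · obtain ⟨c, hcl, hcx⟩ := exists_common hl
      obtain ⟨T, hT, hTl⟩ := exists_parallel (0 : P) l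
      obtain ⟨b, hb, rfl⟩ := F.exists_eq_direction hO hT
        (by rintro rfl; exact hl hTl.symm)
      obtain ⟨b, rfl⟩ : ∃ d : F.Segment, d.1 = b := ⟨⟨b, hb⟩, rfl⟩
      obtain ⟨c, rfl⟩ : ∃ d : F.Segment, d.1 = c := ⟨⟨c, hcx⟩, rfl⟩
      refine Or.inr ⟨b, c, fun p => ?_⟩
      rw [ext, hadd, hmul]
      exact Frame.mem_iff_of_parallel_direction hO hTl.symm hcl p
  have hline_y : ∀ c, ∃ l : L, ∀ p : P, p ∈ l ↔ (Frame.coordinates hO p).2 = c := by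
    intro c
    obtain ⟨l, hl, hlX⟩ := exists_parallel (F.toY c.1) F.xAxis
    exact ⟨l, Frame.mem_iff_of_parallel_x hO hlX hl⟩
  have hline_b : ∀ b c, ∃ l : L, ∀ p : P, p ∈ l ↔
      (Frame.coordinates hO p).1 + b * (Frame.coordinates hO p).2 = c := by
    intro b c
    obtain ⟨l, hl, hlS⟩ := exists_parallel c.1 (F.direction b.1)
    refine ⟨l, fun p => ?_⟩
    rw [ext, hadd, hmul]
    exact Frame.mem_iff_of_parallel_direction hO hlS hl p
  refine ⟨K, hzero, hone, fun g hg hgX a b c => ?_, fun a b c => ?_, Frame.coordinates hO,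
    fun p x y => ?_, fun l => ?_, fun c => ?_, fun a c => ?_, hline, hline_y, hline_b⟩
  · rw [Frame.isSum_iff hO hg hgX, ext, hadd]
  · rw [Frame.isProduct_iff hO, ext, hmul]
  · rw [Frame.hasCoordinates_iff hO, Frame.coordinates_eq_iff]
  · rcases hline l with ⟨c, hc⟩ | ⟨b, c, hc⟩
    · exact Or.inr ⟨0, c, fun p => by rw [hc, zero_mul, add_zero]⟩
    · by_cases hb : b = 0
      · subst hb
        exact Or.inl ⟨c, fun p => by rw [hc, zero_mul, add_zero]⟩
      · refine Or.inr ⟨b⁻¹, b⁻¹ * c, fun p => ?_⟩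
        rw [hc, AlternativeField.add_mul_eq_iff hb]
  · obtain ⟨l, hl⟩ := hline_b 0 c
    exact ⟨l, fun p => by rw [hl, zero_mul, add_zero]⟩
  · by_cases ha : a = 0
    · subst ha
      obtain ⟨l, hl⟩ := hline_y c
      exact ⟨l, fun p => by rw [hl, zero_mul, add_zero]⟩
    · obtain ⟨l, hl⟩ := hline_b a⁻¹ (a⁻¹ * c)
      exact ⟨l, fun p => by rw [hl, AlternativeField.add_mul_eq_iff ha]⟩
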